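/- Let $0<\alpha<1$. For $c\in(0,2^{\alpha-1})$ put $f(x)=c\,x^{\alpha-1}$, $x\in\mathbb N=\{1,2,\dots\}$, and for each $n\in\mathbb N$ let $(\xi^{(*,n)}_i)_{i\ge1}$ be a $\mathrm{GBP}^*(f)$ sequence, i.e. a $\{0,1\}$-valued sequence with $$P\big(\xi^{(*,n)}_{i_1}=\dots=\xi^{(*,n)}_{i_k}=1\big)=\prod_{j=1}^k f(i_j-i_{j-1})\qquad\text{for all } k\ge 1,\ 0=i_0<i_1<\dots<i_k .$$ A process $(X^*_t)_{t>0}$ is called an $\mathrm{ML}^*(\alpha)$ process if, for some such $c$ and such sequences, the scaled random walks $n^{-\alpha}\sum_{1\le i\le\lfloor nt\rfloor}\xi^{(*,n)}_i$, $t>0$, converge as $n\to\infty$ to $\big(c\,\Gamma(\alpha)X_t^*\big)_{t>0}$ in the sense of finite-dimensional distributions. **Proposition 3.12 (increments of $\mathrm{ML}^*(\alpha)$).** Let $X^*$ be an $\mathrm{ML}^*(\alpha)$ process and write $\nabla X_t^*=X_t^*-X_{t-d}^*$ for $0<d<t$. Below, $\sim$ means that the ratio of the two sides tends to $1$. (i)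 For all $s,t>0$, the product $\nabla X_s^*\,\nabla X_{s+t}^*$ is integrable for $0<d<\min(s,t)$, and as $d\downarrow0$ $$\mathrm E\big(\nabla X_s^*\,\nabla X_{s+t}^*\big)\sim \Gamma(\alpha)^{-2}\,d^2\,s^{\alpha-1}t^{\alpha-1}.$$ (ii) For all $m\in\mathbb N$, all $0=t_0<t_1<\dots<t_m$ and all $k_1,\dots,k_m\in\mathbb N$, the product $\prod_{i=1}^m(\nabla X_{t_i}^*)^{k_i}$ is integrable for $0<d<t_1$, and as $d\downarrow0$ $$\mathrm E\Big(\prod_{i=1}^m(\nabla X_{t_i}^*)^{k_i}\Big)\sim d^{\,\sum_{i=1}^m(\alpha(k_i-1)+1)}\prod_{i=1}^m\frac{k_i!\,(t_i-t_{i-1})^{\alpha-1}}{\Gamma\big((k_i-1)\alpha+2\big)\,\Gamma(\alpha)}.$$ -/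

import Mathlib

open MeasureTheory Filter
open scoped Topology Asymptotics

/-- `ξ 1, ξ 2, …` is a non-stationary generalized Bernoulli process `GBP*(f)`: a binary sequence
whose joint probabilities of ones are
`P(ξ_{i_1} = 1, …, ξ_{i_k} = 1) = ∏_{j=1}^k f (i_j - i_{j-1})` for `0 = i_0 < i_1 < ⋯ < i_k`,
i.e. the stationary process `GBP(f)` observed after, and conditioned on, a one at the initial site.
As the sequence is binary, inclusion-exclusion then gives all its finite-dimensional laws.
(`ξ 0` plays no role.) -/
structure IsGBPStar (f : ℕ → ℝ) {Ω : Type*} [MeasurableSpace Ω] (P : Measure Ω)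
    (ξ : ℕ → Ω → ℝ) : Prop where
  measurable : ∀ i, 1 ≤ i → Measurable (ξ i)
  binary : ∀ i, 1 ≤ i → ∀ ω, ξ i ω = 0 ∨ ξ i ω = 1
  prob_ones : ∀ (k : ℕ) (i : Fin (k + 1) → ℕ), StrictMono i → i 0 = 0 →
    P.real {ω | ∀ j : Fin k, ξ (i j.succ) ω = 1} = ∏ j : Fin k, f (i j.succ - i j.castSucc)

/-- The scaled random walk `n^{-α} ∑_{1 ≤ i ≤ ⌊n t⌋} ξ_i`. -/
noncomputable def scaledWalk (α : ℝ) (n : ℕ) {Ω : Type*} (ξ : ℕ → Ω → ℝ) (t : ℝ) (ω : Ω) : ℝ :=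
  (∑ i ∈ Finset.Icc 1 ⌊(n : ℝ) * t⌋₊, ξ i ω) / (n : ℝ) ^ α

/-- `(X t)_{t > 0}` is a Mittag-Leffler process `ML*(α)`: for some `c ∈ (0, 2^{α-1})`, the scaled
random walks driven by `GBP*(f)` sequences with `f x = c x^{α-1}` converge to `ν X`,
`ν = c Γ(α)`, in the sense of finite-dimensional distributions (this determines the law of the
process; the walk of each size `n` may live on its own probability space). -/
def IsMLStar (α : ℝ) {Ω : Type*} [MeasurableSpace Ω] (μ : Measure Ω) [IsProbabilityMeasure μ]
    (X : ℝ → Ω → ℝ) : Prop :=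
  ∃ c : ℝ, 0 < c ∧ c < (2 : ℝ) ^ (α - 1) ∧
  ∃ (Ω' : ℕ → Type) (_ : ∀ n, MeasurableSpace (Ω' n)) (P : ∀ n, Measure (Ω' n))
    (_ : ∀ n, IsProbabilityMeasure (P n)) (ξ : ∀ n, ℕ → Ω' n → ℝ),
    (∀ n, IsGBPStar (fun x => c * (x : ℝ) ^ (α - 1)) (P n) (ξ n)) ∧
    ∀ (m : ℕ) (t : Fin m → ℝ), (∀ i, 0 < t i) →
      TendstoInDistribution (fun n ω (i : Fin m) => scaledWalk α n (ξ n) (t i) ω) atTop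
        (fun ω (i : Fin m) => c * Real.Gamma α * X (t i) ω) P μ

/-! Each increment `X t_i - X (t_i - d)` is the limit of the scaled number of ones in a discrete
window `(⌊n(t_i-d)⌋, ⌊n t_i⌋]`. A falling factorial of order `k` of such a count is `k!` times the
number of `k`-chains of ones in the window. By the product formula for `GBP*(f)` the expected number
of chains is a sum of products of `f` over gaps. Gaps inside one window form iterated convolutions
of `x^{α-1}`, whose asymptotics come from Beta integrals and produce `d^{(k-1)α+1} / Γ((k-1)α+2)`.
The gap leading into window `i` from the previous one lies, after scaling, between `t_i - d -
t_{i-1}` and `t_i - t_{i-1} + d`; since `f` is decreasing, this gives two-sided bounds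
(`IsGBPStar.integral_prod_fallingCount_bounds`).

For fixed `d`, uniform moment bounds make the scaled mixed factorial moments converge to the mixed
moments of the increments (`integrable_and_tendsto_increments`), so the bounds survive as `n → ∞`
(`moment_increments_bounds`). As `d ↓ 0` both bounds have the same leading term. Statement (i) is
the case of two windows with exponents one. -/

/-! ### Riemann sums, Beta integrals and convolution with a power kernel. -/

theorem integral_comp_floor_mul (h : ℕ → ℝ) {N : ℕ} (hN : N ≠ 0) :
    ∫ u in (0 : ℝ)..1, h ⌊u * N⌋₊ = (∑ y ∈ Finset.range N, h y) / N := by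
  have hN' : (N : ℝ) ≠ 0 := by exact_mod_cast hN
  have hpiece : ∀ k : ℕ, Set.EqOn (fun _ : ℝ => h k) (fun x : ℝ => h ⌊x⌋₊)
      (Set.Ioo (k : ℝ) ((k + 1 : ℕ) : ℝ)) := by
    intro k x hx
    have : ⌊x⌋₊ = k := by
      rw [Nat.floor_eq_iff (le_trans (Nat.cast_nonneg k) hx.1.le)]
      exact ⟨hx.1.le, by simpa using hx.2⟩
    simp [this]
  have hle : ∀ k : ℕ, (k : ℝ) ≤ ((k + 1 : ℕ) : ℝ) := fun k => by simp
  have hint : ∀ k : ℕ, IntervalIntegrable (fun x : ℝ => h ⌊x⌋₊) volume (k : ℝ) ((k + 1 : ℕ) : ℝ) := by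
    intro k
    rw [intervalIntegrable_iff_integrableOn_Ioo_of_le (hle k)]
    exact IntegrableOn.congr_fun (by simp) (hpiece k) measurableSet_Ioo
  have hval : ∀ k : ℕ, ∫ x in (k : ℝ)..((k + 1 : ℕ) : ℝ), h ⌊x⌋₊ = h k := by
    intro k
    rw [intervalIntegral.integral_of_le (hle k), integral_Ioc_eq_integral_Ioo,
      ← setIntegral_congr_fun measurableSet_Ioo (hpiece k)]
    simp
  rw [intervalIntegral.integral_comp_mul_right (fun x => h ⌊x⌋₊) hN', zero_mul, one_mul]
  have := intervalIntegral.sum_integral_adjacent_intervals (a := fun k : ℕ => (k : ℝ)) (n := N)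
    (f := fun x : ℝ => h ⌊x⌋₊) (μ := volume) (fun k _ => hint k)
  simp only [Nat.cast_zero] at this
  rw [← this, Finset.sum_congr rfl (fun k _ => hval k), smul_eq_mul, inv_mul_eq_div]

theorem integral_rpow_mul_one_sub_rpow {a b : ℝ} (ha : 0 < a) (hb : 0 < b) :
    ∫ u in (0 : ℝ)..1, u ^ (a - 1) * (1 - u) ^ (b - 1)
      = Real.Gamma a * Real.Gamma b / Real.Gamma (a + b) := by
  have h := ProbabilityTheory.beta_eq_betaIntegralReal a b ha hb
  rw [ProbabilityTheory.beta] at h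
  rw [h, Complex.betaIntegral]
  have : ∀ u ∈ Set.uIcc (0 : ℝ) 1, (u : ℂ) ^ ((a : ℂ) - 1) * (1 - (u : ℂ)) ^ ((b : ℂ) - 1)
      = ((u ^ (a - 1) * (1 - u) ^ (b - 1) : ℝ) : ℂ) := by
    intro u hu
    rw [Set.uIcc_of_le zero_le_one] at hu
    push_cast
    rw [Complex.ofReal_cpow hu.1, Complex.ofReal_cpow (by linarith [hu.2])]
    push_cast
    rfl
  rw [intervalIntegral.integral_congr this, intervalIntegral.integral_ofReal, Complex.ofReal_re]

/-- Convolution of a regularly growing sequence with a power kernel. -/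
theorem tendsto_sum_mul_rpow {α β A : ℝ} (hα0 : 0 < α) (hα1 : α ≤ 1) (hβ : 1 ≤ β) {a : ℕ → ℝ}
    (ha : Tendsto (fun n : ℕ => a n / (n : ℝ) ^ (β - 1)) atTop (𝓝 A)) :
    Tendsto (fun N : ℕ => (∑ y ∈ Finset.Ico 1 N, a y * ((N - y : ℕ) : ℝ) ^ (α - 1)) /
      (N : ℝ) ^ (α + β - 1)) atTop
      (𝓝 (A * (Real.Gamma β * Real.Gamma α / Real.Gamma (β + α)))) := by
  obtain ⟨C, hC⟩ : ∃ C, ∀ n : ℕ, |a n / (n : ℝ) ^ (β - 1)| ≤ C := by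
    obtain ⟨C, hC⟩ := (Metric.isBounded_range_of_tendsto _ ha).exists_norm_le
    exact ⟨C, fun n => hC _ ⟨n, rfl⟩⟩
  have hC0 : 0 ≤ C := (abs_nonneg _).trans (hC 0)
  -- The sum becomes the integral of a step function over `[0,1]`. The cell width supplies the
  -- missing factor `1/N` of the normalisation, and the cell `y = 0` is silenced because the sum
  -- starts at `1`.
  let h : ℕ → ℕ → ℝ := fun N y => if y = 0 then 0 else
    a y * ((N - y : ℕ) : ℝ) ^ (α - 1) / (N : ℝ) ^ (α + β - 2)
  have heq : ∀ᶠ N : ℕ in atTop, ∫ u in (0 : ℝ)..1, h N ⌊u * N⌋₊ =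
      (∑ y ∈ Finset.Ico 1 N, a y * ((N - y : ℕ) : ℝ) ^ (α - 1)) / (N : ℝ) ^ (α + β - 1) := by
    filter_upwards [eventually_ge_atTop 1] with N hN
    have hN0 : (0 : ℝ) < N := by exact_mod_cast hN
    rw [integral_comp_floor_mul _ (by lia), Finset.range_eq_Ico,
      Finset.sum_eq_sum_Ico_succ_bot (by lia)]
    simp only [h, if_true, zero_add]
    rw [Finset.sum_congr rfl (g := fun y => a y * ((N - y : ℕ) : ℝ) ^ (α - 1) /
      (N : ℝ) ^ (α + β - 2)), ← Finset.sum_div, div_div]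
    · congr 1
      rw [← Real.rpow_add_one hN0.ne']
      congr 1; ring
    · intro y hy
      rw [if_neg]
      have := (Finset.mem_Ico.1 hy).1
      lia
  refine Tendsto.congr' heq ?_
  rw [← integral_rpow_mul_one_sub_rpow (by linarith) hα0, ← intervalIntegral.integral_const_mul]
  have hbdint : IntervalIntegrable (fun u : ℝ => C * (1 - u) ^ (α - 1)) volume 0 1 := by
    have h1 := (intervalIntegral.intervalIntegrable_rpow' (a := 0) (b := 1)
      (show -1 < α - 1 by linarith)).comp_sub_left 1
    simp only [sub_zero, sub_self] at h1
    exact h1.symm.const_mul C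
  refine intervalIntegral.tendsto_integral_filter_of_dominated_convergence
    (fun u => C * (1 - u) ^ (α - 1)) ?_ ?_ hbdint ?_
  · refine Eventually.of_forall fun N => Measurable.aestronglyMeasurable ?_
    exact (measurable_from_nat (f := h N)).comp
      (Nat.measurable_floor.comp (measurable_id.mul_const _))
  · filter_upwards [eventually_ge_atTop 1] with N hN
    have hN0 : (0 : ℝ) < N := by exact_mod_cast hN
    filter_upwards [(Set.countable_singleton (1 : ℝ)).ae_notMem volume] with u hu1 hu
    rw [Set.uIoc_of_le zero_le_one] at hu
    have hu1 : u < 1 := lt_of_le_of_ne hu.2 hu1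
    have hu0 : 0 < u := hu.1
    simp only [h]
    set y := ⌊u * N⌋₊ with hy
    have hyle : (y : ℝ) ≤ u * N := Nat.floor_le (by positivity)
    have hyN : (y : ℝ) < N := hyle.trans_lt (by nlinarith)
    have hyN' : y ≤ N := by exact_mod_cast hyN.le
    split_ifs with hy0
    · simp only [norm_zero]
      have : (0 : ℝ) < 1 - u := by linarith
      positivity
    · have hypos : (0 : ℝ) < y := by exact_mod_cast Nat.pos_of_ne_zero hy0
      have hay : |a y| ≤ C * (N : ℝ) ^ (β - 1) := by
        have h1 := hC y
        rw [abs_div, abs_of_pos (Real.rpow_pos_of_pos hypos _),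
          div_le_iff₀ (Real.rpow_pos_of_pos hypos _)] at h1
        refine h1.trans ?_
        gcongr
      -- Since `y ≤ uN`, the distance `N - y` is at least `N(1-u)`, and the exponent is nonpositive;
      -- the resulting majorant is integrable because `α > 0`.
      have hk : ((N - y : ℕ) : ℝ) ^ (α - 1) ≤ (N : ℝ) ^ (α - 1) * (1 - u) ^ (α - 1) := by
        rw [← Real.mul_rpow hN0.le (by linarith), Nat.cast_sub hyN']
        exact Real.rpow_le_rpow_of_nonpos (by nlinarith) (by nlinarith) (by linarith)
      rw [Real.norm_eq_abs, abs_div, abs_mul, abs_of_pos (Real.rpow_pos_of_pos hN0 _),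
        abs_of_nonneg (Real.rpow_nonneg (Nat.cast_nonneg _) _),
        div_le_iff₀ (Real.rpow_pos_of_pos hN0 _)]
      calc |a y| * ((N - y : ℕ) : ℝ) ^ (α - 1)
          ≤ (C * (N : ℝ) ^ (β - 1)) * ((N : ℝ) ^ (α - 1) * (1 - u) ^ (α - 1)) := by gcongr
        _ = C * (1 - u) ^ (α - 1) * ((N : ℝ) ^ (β - 1) * (N : ℝ) ^ (α - 1)) := by ring
        _ = _ := by
          rw [← Real.rpow_add hN0]
          congr 2; ring
  · filter_upwards [(Set.countable_singleton (1 : ℝ)).ae_notMem volume] with u hu1 hu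
    rw [Set.uIoc_of_le zero_le_one] at hu
    have hu1 : u < 1 := lt_of_le_of_ne hu.2 hu1
    have hu0 : 0 < u := hu.1
    have hfl : Tendsto (fun N : ℕ => ⌊u * N⌋₊) atTop atTop :=
      tendsto_nat_floor_atTop.comp
        (Tendsto.const_mul_atTop hu0 tendsto_natCast_atTop_atTop)
    have hdiv : Tendsto (fun N : ℕ => (⌊u * N⌋₊ : ℝ) / N) atTop (𝓝 u) :=
      (tendsto_nat_floor_mul_div_atTop hu0.le).comp tendsto_natCast_atTop_atTop
    have h1 := ((ha.comp hfl).mul (hdiv.rpow_const (p := β - 1) (Or.inl hu0.ne'))).mul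
      ((tendsto_const_nhds (x := (1 : ℝ))).sub hdiv |>.rpow_const (p := α - 1)
        (Or.inl (by linarith)))
    rw [← mul_assoc]
    refine h1.congr' ?_
    filter_upwards [eventually_ge_atTop 1, hfl.eventually_ge_atTop 1] with N hN hy1
    have hN0 : (0 : ℝ) < N := by exact_mod_cast hN
    simp only [h, Function.comp]
    set y := ⌊u * N⌋₊ with hy
    have hyle : (y : ℝ) ≤ u * N := Nat.floor_le (by positivity)
    have hyN : (y : ℝ) < N := hyle.trans_lt (by nlinarith)
    have hyN' : y ≤ N := by exact_mod_cast hyN.le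
    have hypos : (0 : ℝ) < y := by exact_mod_cast hy1
    rw [if_neg (by lia), Nat.cast_sub hyN', Real.div_rpow hypos.le hN0.le,
      one_sub_div hN0.ne', Real.div_rpow (by linarith) hN0.le,
      show α + β - 2 = (β - 1) + (α - 1) by ring, Real.rpow_add hN0]
    have p1 := Real.rpow_pos_of_pos hypos (β - 1)
    have p2 := Real.rpow_pos_of_pos hN0 (β - 1)
    have p3 := Real.rpow_pos_of_pos hN0 (α - 1)
    field_simp

/-! ### Asymptotics of sums over chains. -/

/-- `gapSum f k x` is the sum of `∏ f (gaps)` over chains `0 < y₁ < ⋯ < y_k < x`, the gaps being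
those between consecutive points, up to and including `x`. -/
noncomputable def gapSum (f : ℕ → ℝ) : ℕ → ℕ → ℝ
  | 0, _ => 1
  | k + 1, x => ∑ y ∈ Finset.Ico 1 x, gapSum f k y * f (x - y)

/-- The sum of `gapSum f k` over endpoints `1 ≤ x ≤ N`. -/
noncomputable def gapTotal (f : ℕ → ℝ) (k N : ℕ) : ℝ := ∑ x ∈ Finset.Icc 1 N, gapSum f k x

theorem gapSum_nonneg {f : ℕ → ℝ} (hf : ∀ x, 0 ≤ f x) : ∀ k x, 0 ≤ gapSum f k x
  | 0, _ => zero_le_one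
  | k + 1, _ => Finset.sum_nonneg fun y _ => mul_nonneg (gapSum_nonneg hf k y) (hf _)

theorem gapTotal_nonneg {f : ℕ → ℝ} (hf : ∀ x, 0 ≤ f x) (k N : ℕ) : 0 ≤ gapTotal f k N :=
  Finset.sum_nonneg fun x _ => gapSum_nonneg hf k x

/-- Each further convolution with `c x^{α-1}` multiplies the constant by `c Γ(kα+1) Γ(α) /
Γ((k+1)α+1)`, and these factors telescope. -/
theorem tendsto_gapSum {α c : ℝ} (hα0 : 0 < α) (hα1 : α ≤ 1) (k : ℕ) :
    Tendsto (fun x : ℕ => gapSum (fun x => c * (x : ℝ) ^ (α - 1)) k x / (x : ℝ) ^ (k * α)) atTop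
      (𝓝 (c ^ k * Real.Gamma α ^ k / Real.Gamma (k * α + 1))) := by
  induction k with
  | zero => simp [gapSum]
  | succ k ih =>
    have hk : (0 : ℝ) ≤ k * α := by positivity
    have h := (tendsto_sum_mul_rpow hα0 hα1 (β := k * α + 1) (by linarith)
      (a := gapSum (fun x => c * (x : ℝ) ^ (α - 1)) k) (by simpa using ih)).const_mul c
    have hΓ : Real.Gamma (k * α + 1) ≠ 0 := (Real.Gamma_pos_of_pos (by linarith)).ne'
    convert h using 2 with x
    · rw [gapSum, ← mul_div_assoc, Finset.mul_sum]
      congr 1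
      · exact Finset.sum_congr rfl fun y _ => by ring
      · congr 1; push_cast; ring
    · rw [show ((k + 1 : ℕ) : ℝ) * α + 1 = k * α + 1 + α by push_cast; ring]
      field_simp
      ring

/-- Summation is convolution with the constant kernel, i.e. exponent `α = 1`. The endpoint `x = N`,
absent from `Ico 1 N`, adds a term of relative order `1/N`. -/
theorem tendsto_gapTotal {α c : ℝ} (hα0 : 0 < α) (hα1 : α ≤ 1) (k : ℕ) :
    Tendsto (fun N : ℕ => gapTotal (fun x => c * (x : ℝ) ^ (α - 1)) k N / (N : ℝ) ^ (k * α + 1))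
      atTop (𝓝 (c ^ k * Real.Gamma α ^ k / Real.Gamma (k * α + 2))) := by
  have hk : (0 : ℝ) ≤ k * α := by positivity
  have hΓ : Real.Gamma (k * α + 1) ≠ 0 := (Real.Gamma_pos_of_pos (by linarith)).ne'
  have h0 := tendsto_gapSum (c := c) hα0 hα1 k
  have h1 := (tendsto_sum_mul_rpow (α := 1) (β := k * α + 1) zero_lt_one le_rfl (by linarith)
      (a := gapSum (fun x => c * (x : ℝ) ^ (α - 1)) k) (by simpa using h0)).add
    (h0.mul (tendsto_one_div_atTop_nhds_zero_nat (𝕜 := ℝ)))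
  convert h1.congr' ?_ using 2
  · rw [Real.Gamma_one, show k * α + 1 + 1 = k * α + 2 by ring]
    field_simp
    simp
  · filter_upwards [eventually_ge_atTop 1] with N hN
    have hN0 : (0 : ℝ) < N := by exact_mod_cast hN
    rw [gapTotal, ← Finset.Ico_insert_right hN, Finset.sum_insert (by simp),
      show 1 + (k * α + 1) - 1 = k * α + 1 by ring, Real.rpow_add_one hN0.ne']
    have := Real.rpow_pos_of_pos hN0 (k * α)
    simp
    field_simp
    ring

/-! ### From convergence in distribution to convergence of means. -/

section Moments

variable {Ω : Type*} [MeasurableSpace Ω] {μ : Measure Ω} [IsProbabilityMeasure μ]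
  {Ω' : ℕ → Type*} [∀ n, MeasurableSpace (Ω' n)] {P : ∀ n, Measure (Ω' n)}
  [∀ n, IsProbabilityMeasure (P n)]

theorem MeasureTheory.TendstoInDistribution.tendsto_integral_comp {E : Type*} [TopologicalSpace E]
    [MeasurableSpace E] [OpensMeasurableSpace E] {V : ∀ n, Ω' n → E} {Z : Ω → E}
    (h : TendstoInDistribution V atTop Z P μ) {φ : E → ℝ} (hφ : Continuous φ) {K : ℝ}
    (hK : ∀ x, |φ x| ≤ K) :
    Tendsto (fun n => ∫ ω, φ (V n ω) ∂P n) atTop (𝓝 (∫ ω, φ (Z ω) ∂μ)) := by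
  have h1 := (ProbabilityMeasure.tendsto_iff_forall_integral_tendsto.1 h.tendsto)
    (BoundedContinuousFunction.ofNormedAddCommGroup φ hφ K hK)
  simp only [ProbabilityMeasure.coe_mk, BoundedContinuousFunction.coe_ofNormedAddCommGroup] at h1
  rw [integral_map h.aemeasurable_limit hφ.measurable.aestronglyMeasurable] at h1
  refine h1.congr fun n => ?_
  rw [integral_map (h.forall_aemeasurable n) hφ.measurable.aestronglyMeasurable]

/-- Truncation changes `z` only when `|z| > K`, and then by at most `|z| ≤ z² / K`. -/
theorem abs_sub_truncate_le (z : ℝ) {K : ℝ} (hK : 0 < K) :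
    |z - max (-K) (min z K)| ≤ z ^ 2 / K := by
  rw [le_div_iff₀ hK]
  rcases le_total z K with h1 | h1
  · rw [min_eq_left h1]
    rcases le_total (-K) z with h2 | h2
    · rw [max_eq_right h2]; simp; positivity
    · rw [max_eq_left h2, abs_of_nonpos (by linarith)]; nlinarith
  · rw [min_eq_right h1, max_eq_right (by linarith), abs_of_nonneg (by linarith)]; nlinarith

theorem abs_truncate_le (z : ℝ) {K : ℝ} (hK : 0 < K) : |max (-K) (min z K)| ≤ K :=
  abs_le.2 ⟨le_max_left _ _, max_le (by linarith) (min_le_right _ _)⟩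

theorem abs_integral_sub_integral_truncate_le {Y : Ω → ℝ} (hY : AEMeasurable Y μ)
    (hYi : Integrable Y μ) (hY2 : Integrable (fun ω => Y ω ^ 2) μ) {C : ℝ}
    (hYC : ∫ ω, Y ω ^ 2 ∂μ ≤ C) {K : ℝ} (hK : 0 < K) :
    |∫ ω, Y ω ∂μ - ∫ ω, max (-K) (min (Y ω) K) ∂μ| ≤ C / K := by
  rw [← integral_sub hYi (Integrable.of_bound (by fun_prop) K
    (Eventually.of_forall fun ω => abs_truncate_le _ hK))]
  refine (abs_integral_le_integral_abs).trans ?_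
  refine (integral_mono_of_nonneg (Eventually.of_forall fun ω => abs_nonneg _) (hY2.div_const K)
    (Eventually.of_forall fun ω => abs_sub_truncate_le _ hK)).trans ?_
  rw [integral_div]
  gcongr

theorem map_prodMk_const_eq_prod_dirac {E F : Type*} [MeasurableSpace E] [MeasurableSpace F]
    {V : Ω → E} (hV : AEMeasurable V μ) (e : F) :
    μ.map (fun ω => (V ω, e)) = (μ.map V).prod (Measure.dirac e) := by
  rw [Measure.prod_dirac, AEMeasurable.map_map_of_aemeasurable (by fun_prop) hV]
  rfl

/-- Convergence in distribution with bounded second moments implies convergence of means. -/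
theorem tendsto_integral_of_sq_bounded {Z : Ω → ℝ} {Zn : ∀ n, Ω' n → ℝ}
    (h : TendstoInDistribution Zn atTop Z P μ)
    (hint : ∀ᶠ n in atTop, Integrable (fun ω => Zn n ω ^ 2) (P n)) {C : ℝ}
    (hC : ∀ᶠ n in atTop, ∫ ω, Zn n ω ^ 2 ∂P n ≤ C) :
    Integrable Z μ ∧ Tendsto (fun n => ∫ ω, Zn n ω ∂P n) atTop (𝓝 (∫ ω, Z ω ∂μ)) := by
  have hZm : AEMeasurable Z μ := h.aemeasurable_limit
  have hC0 : 0 ≤ C := by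
    obtain ⟨n, hn⟩ := hC.exists
    exact (integral_nonneg fun ω => sq_nonneg _).trans hn
  -- The second-moment bound passes to the limit law through bounded continuous truncations; Fatou's
  -- lemma then removes the truncation.
  have htr : ∀ K : ℕ, ∫ ω, min (Z ω ^ 2) K ∂μ ≤ C := by
    intro K
    have h1 := h.tendsto_integral_comp (φ := fun z => min (z ^ 2) (K : ℝ)) (by fun_prop)
      (K := K) (fun z => by
        rw [abs_of_nonneg (by positivity)]
        exact min_le_right _ _)
    refine le_of_tendsto h1 ?_
    filter_upwards [hint, hC] with n h2 h3
    refine (integral_mono_of_nonneg (Eventually.of_forall fun ω => by positivity) h2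
      (Eventually.of_forall fun ω => min_le_left _ _)).trans h3
  have hlin : ∫⁻ ω, ENNReal.ofReal (Z ω ^ 2) ∂μ ≤ ENNReal.ofReal C := by
    have hlim : ∀ ω, liminf (fun K : ℕ => ENNReal.ofReal (min (Z ω ^ 2) K)) atTop
        = ENNReal.ofReal (Z ω ^ 2) := by
      intro ω
      refine Tendsto.liminf_eq (tendsto_const_nhds.congr' ?_)
      filter_upwards [eventually_ge_atTop ⌈Z ω ^ 2⌉₊] with K hK
      rw [min_eq_left (Nat.ceil_le.1 hK)]
    simp_rw [← hlim]
    refine (lintegral_liminf_le' fun K => by fun_prop).trans ?_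
    refine liminf_le_of_frequently_le' (Eventually.frequently (Eventually.of_forall fun K => ?_))
    rw [← ofReal_integral_eq_lintegral_ofReal]
    · exact ENNReal.ofReal_le_ofReal (htr K)
    · refine Integrable.of_bound (by fun_prop) K (Eventually.of_forall fun ω => ?_)
      rw [Real.norm_eq_abs, abs_of_nonneg (by positivity)]
      exact min_le_right _ _
    · exact Eventually.of_forall fun ω => by positivity
  have hZ2 : Integrable (fun ω => Z ω ^ 2) μ := by
    refine ⟨by fun_prop, ?_⟩
    rw [hasFiniteIntegral_iff_ofReal (Eventually.of_forall fun ω => sq_nonneg _)]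
    exact hlin.trans_lt ENNReal.ofReal_lt_top
  have hZC : ∫ ω, Z ω ^ 2 ∂μ ≤ C := by
    rw [integral_eq_lintegral_of_nonneg_ae (Eventually.of_forall fun ω => sq_nonneg _)
      (by fun_prop)]
    exact ENNReal.toReal_le_of_le_ofReal hC0 hlin
  have hZi : Integrable Z μ :=
    ((memLp_two_iff_integrable_sq hZm.aestronglyMeasurable).2 hZ2).integrable (by norm_num)
  have hZt := fun K hK => abs_integral_sub_integral_truncate_le hZm hZi hZ2 hZC (K := K) hK
  refine ⟨hZi, Metric.tendsto_nhds.2 fun ε hε => ?_⟩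
  -- Makes each of the two truncation errors less than `ε / 3`; the `+ 1` keeps `K` positive when `C
  -- = 0`.
  set K : ℝ := 3 * C / ε + 1 with hKdef
  have hK : 0 < K := by positivity
  have hCK : C / K < ε / 3 := by
    rw [div_lt_iff₀ hK, hKdef]
    field_simp
    linarith
  have hφ := h.tendsto_integral_comp (φ := fun z => max (-K) (min z K)) (by fun_prop)
    (fun z => abs_truncate_le z hK)
  filter_upwards [hint, hC, Metric.tendsto_nhds.1 hφ (ε / 3) (by positivity)] with n h2 h3 h4
  have hYm := h.forall_aemeasurable n
  have hYi : Integrable (Zn n) (P n) :=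
    ((memLp_two_iff_integrable_sq hYm.aestronglyMeasurable).2 h2).integrable (by norm_num)
  have h5 := abs_integral_sub_integral_truncate_le hYm hYi h2 h3 hK
  have h6 := hZt K hK
  rw [Real.dist_eq] at h4 ⊢
  rw [abs_le] at h5 h6
  rw [abs_lt] at h4 ⊢
  constructor <;> linarith

/-- Convergence in distribution with a deterministic, convergent, perturbation and bounded second
moments implies convergence of means. -/
theorem tendsto_integral_of_sq_bounded_of_perturbation {E : Type*} [PseudoMetricSpace E]
    [SecondCountableTopology E] [MeasurableSpace E] [BorelSpace E] {V : ∀ n, Ω' n → E} {Z : Ω → E}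
    (h : TendstoInDistribution V atTop Z P μ) {ε : ℕ → ℝ} {e : ℝ} (hε : Tendsto ε atTop (𝓝 e))
    {G : E × ℝ → ℝ} (hG : Continuous G)
    (hint : ∀ᶠ n in atTop, Integrable (fun ω => G (V n ω, ε n) ^ 2) (P n)) {C : ℝ}
    (hC : ∀ᶠ n in atTop, ∫ ω, G (V n ω, ε n) ^ 2 ∂P n ≤ C) :
    Integrable (fun ω => G (Z ω, e)) μ ∧
      Tendsto (fun n => ∫ ω, G (V n ω, ε n) ∂P n) atTop (𝓝 (∫ ω, G (Z ω, e) ∂μ)) := by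
  -- The joint law is a product with a Dirac mass, and products of probability measures are weakly
  -- continuous.
  have hpair : TendstoInDistribution (fun n ω => (V n ω, ε n)) atTop (fun ω => (Z ω, e)) P μ := by
    refine ⟨fun n => (h.forall_aemeasurable n).prodMk aemeasurable_const,
      h.aemeasurable_limit.prodMk aemeasurable_const, ?_⟩
    have h1 := (ProbabilityMeasure.continuous_prod (α := E) (β := ℝ)).tendsto _ |>.comp
      (h.tendsto.prodMk_nhds ((continuous_diracProba (X := ℝ)).tendsto e |>.comp hε))
    have hn : ∀ (n : ℕ), (⟨(P n).map fun ω => (V n ω, ε n), Measure.isProbabilityMeasure_map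
        ((h.forall_aemeasurable n).prodMk aemeasurable_const)⟩ : ProbabilityMeasure (E × ℝ)) =
        ProbabilityMeasure.prod ⟨(P n).map (V n), Measure.isProbabilityMeasure_map
          (h.forall_aemeasurable n)⟩ (diracProba (ε n)) := fun n =>
      ProbabilityMeasure.toMeasure_injective
        (map_prodMk_const_eq_prod_dirac (h.forall_aemeasurable n) (ε n))
    have hlim : (⟨μ.map fun ω => (Z ω, e), Measure.isProbabilityMeasure_map
        (h.aemeasurable_limit.prodMk aemeasurable_const)⟩ : ProbabilityMeasure (E × ℝ)) =
        ProbabilityMeasure.prod ⟨μ.map Z, Measure.isProbabilityMeasure_map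
          h.aemeasurable_limit⟩ (diracProba e) :=
      ProbabilityMeasure.toMeasure_injective
        (map_prodMk_const_eq_prod_dirac h.aemeasurable_limit e)
    rw [hlim]
    exact h1.congr fun n => (hn n).symm
  exact tendsto_integral_of_sq_bounded (hpair.continuous_comp hG) hint hC

end Moments

/-! ### The renewal property of `GBP*`. -/

/-- The binary sequence `ξ 1, ξ 2, …` with a one prepended at the initial site `0`. -/
noncomputable def withOrigin {Ω : Type*} (ξ : ℕ → Ω → ℝ) (i : ℕ) (ω : Ω) : ℝ :=
  if i = 0 then 1 else ξ i ω

@[simp]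
theorem withOrigin_zero {Ω : Type*} (ξ : ℕ → Ω → ℝ) : withOrigin ξ 0 = 1 := by
  ext; simp [withOrigin]

theorem withOrigin_of_ne_zero {Ω : Type*} (ξ : ℕ → Ω → ℝ) {i : ℕ} (hi : i ≠ 0) :
    withOrigin ξ i = ξ i := by
  ext; simp [withOrigin, hi]

theorem Finset.prod_eq_ite_of_binary {ι : Type*} (s : Finset ι) {x : ι → ℝ}
    (hx : ∀ i ∈ s, x i = 0 ∨ x i = 1) [Decidable (∀ i ∈ s, x i = 1)] :
    ∏ i ∈ s, x i = if ∀ i ∈ s, x i = 1 then 1 else 0 := by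
  split_ifs with h
  · exact Finset.prod_eq_one h
  · push Not at h
    obtain ⟨i, hi, h1⟩ := h
    exact Finset.prod_eq_zero hi ((hx i hi).resolve_right h1)

theorem Finset.prod_mul_prod_of_binary {ι : Type*} [DecidableEq ι] (s t : Finset ι) {x : ι → ℝ}
    (hx : ∀ i, x i = 0 ∨ x i = 1) :
    (∏ i ∈ s, x i) * ∏ i ∈ t, x i = ∏ i ∈ s ∪ t, x i := by
  classical
  rw [Finset.prod_eq_ite_of_binary s fun i _ => hx i, Finset.prod_eq_ite_of_binary t fun i _ => hx i,
    Finset.prod_eq_ite_of_binary (s ∪ t) fun i _ => hx i]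
  simp only [Finset.mem_union, or_imp, forall_and]
  split_ifs <;> simp_all

/-- Random variables that are polynomials in the sites before `y`. -/
abbrev pastAlgebra {Ω : Type*} (η : ℕ → Ω → ℝ) (y : ℕ) : Subalgebra ℝ (Ω → ℝ) :=
  Algebra.adjoin ℝ (η '' Set.Iio y)

theorem pastAlgebra_mono {Ω : Type*} (η : ℕ → Ω → ℝ) {y z : ℕ} (h : y ≤ z) :
    pastAlgebra η y ≤ pastAlgebra η z :=
  Algebra.adjoin_mono (Set.image_mono (Set.Iio_subset_Iio h))

theorem mem_pastAlgebra {Ω : Type*} (η : ℕ → Ω → ℝ) {y z : ℕ} (h : y < z) :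
    η y ∈ pastAlgebra η z :=
  Algebra.subset_adjoin ⟨y, h, rfl⟩

namespace IsGBPStar

variable {f : ℕ → ℝ} {Ω : Type*} [MeasurableSpace Ω] {P : Measure Ω} {ξ : ℕ → Ω → ℝ}

theorem withOrigin_binary (h : IsGBPStar f P ξ) (i : ℕ) (ω : Ω) :
    withOrigin ξ i ω = 0 ∨ withOrigin ξ i ω = 1 := by
  by_cases hi : i = 0
  · simp [hi]
  · rw [withOrigin_of_ne_zero ξ hi]
    exact h.binary i (Nat.one_le_iff_ne_zero.2 hi) ω

theorem withOrigin_nonneg (h : IsGBPStar f P ξ) (i : ℕ) (ω : Ω) : 0 ≤ withOrigin ξ i ω := by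
  rcases h.withOrigin_binary i ω with h | h <;> simp [h]

theorem withOrigin_measurable (h : IsGBPStar f P ξ) (i : ℕ) : Measurable (withOrigin ξ i) := by
  by_cases hi : i = 0
  · rw [hi, withOrigin_zero]; exact measurable_one
  · rw [withOrigin_of_ne_zero ξ hi]
    exact h.measurable i (Nat.one_le_iff_ne_zero.2 hi)

theorem measurable_and_bounded_of_mem (h : IsGBPStar f P ξ) {y : ℕ} {Y : Ω → ℝ}
    (hY : Y ∈ pastAlgebra (withOrigin ξ) y) : Measurable Y ∧ ∃ C, ∀ ω, |Y ω| ≤ C := by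
  induction hY using Algebra.adjoin_induction with
  | mem x hx =>
    obtain ⟨a, -, rfl⟩ := hx
    refine ⟨h.withOrigin_measurable a, 1, fun ω => ?_⟩
    rcases h.withOrigin_binary a ω with h | h <;> simp [h]
  | algebraMap r => exact ⟨measurable_const, |r|, fun ω => le_rfl⟩
  | add x y _ _ hx hy =>
    obtain ⟨hx, C, hC⟩ := hx
    obtain ⟨hy, D, hD⟩ := hy
    exact ⟨hx.add hy, C + D, fun ω => (abs_add_le _ _).trans (add_le_add (hC ω) (hD ω))⟩
  | mul x y _ _ hx hy =>
    obtain ⟨hx, C, hC⟩ := hx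
    obtain ⟨hy, D, hD⟩ := hy
    refine ⟨hx.mul hy, C * D, fun ω => ?_⟩
    rw [Pi.mul_apply, abs_mul]
    exact mul_le_mul (hC ω) (hD ω) (abs_nonneg _) ((abs_nonneg _).trans (hC ω))

theorem integrable_of_mem [IsProbabilityMeasure P] (h : IsGBPStar f P ξ) {y : ℕ} {Y : Ω → ℝ}
    (hY : Y ∈ pastAlgebra (withOrigin ξ) y) : Integrable Y P := by
  obtain ⟨hm, C, hC⟩ := h.measurable_and_bounded_of_mem hY
  exact Integrable.of_bound hm.aestronglyMeasurable C (Eventually.of_forall hC)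

theorem integral_prod_withOrigin (h : IsGBPStar f P ξ) {k : ℕ} {i : Fin (k + 1) → ℕ}
    (hi : StrictMono i) (hi0 : i 0 = 0) :
    ∫ ω, ∏ j, withOrigin ξ (i j) ω ∂P = ∏ j : Fin k, f (i j.succ - i j.castSucc) := by
  classical
  rw [← h.prob_ones k i hi hi0]
  have hpos : ∀ j : Fin k, i j.succ ≠ 0 := fun j => by
    have := hi (Fin.succ_pos j)
    lia
  have hms : MeasurableSet {ω | ∀ j : Fin k, ξ (i j.succ) ω = 1} := by
    simp only [Set.ofPred_forall]
    exact MeasurableSet.iInter fun j =>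
      h.measurable _ (Nat.one_le_iff_ne_zero.2 (hpos j)) (measurableSet_singleton 1)
  rw [← integral_indicator_one hms]
  congr 1
  ext ω
  have hiff : (∀ j ∈ Finset.univ, withOrigin ξ (i j) ω = 1) ↔ ∀ j : Fin k, ξ (i j.succ) ω = 1 := by
    simp only [Finset.mem_univ, true_imp_iff, Fin.forall_fin_succ (n := k), hi0,
      withOrigin_zero, Pi.one_apply, true_and]
    exact forall_congr' fun j => by rw [withOrigin_of_ne_zero ξ (hpos j)]
  rw [Finset.prod_eq_ite_of_binary _ fun j _ => h.withOrigin_binary _ _]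
  by_cases hω : ∀ j : Fin k, ξ (i j.succ) ω = 1
  · rw [if_pos (hiff.2 hω), Set.indicator_of_mem (by exact hω), Pi.one_apply]
  · rw [if_neg (mt hiff.1 hω), Set.indicator_of_notMem (by exact hω)]

/-- Appending `z` to the increasing enumeration of `S`, which starts at `0` and ends at `y`, adds
exactly the gap `z - y` to the product formula. -/
theorem integral_prod_mul_withOrigin (h : IsGBPStar f P ξ) {S : Finset ℕ} {y z : ℕ} (h0 : 0 ∈ S)
    (hy : y ∈ S) (hS : ∀ a ∈ S, a ≤ y) (hyz : y < z) :
    ∫ ω, (∏ a ∈ S, withOrigin ξ a ω) * withOrigin ξ z ω ∂P =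
      (∫ ω, ∏ a ∈ S, withOrigin ξ a ω ∂P) * f (z - y) := by
  obtain ⟨k, hk⟩ : ∃ k, S.card = k + 1 :=
    Nat.exists_eq_succ_of_ne_zero (Finset.card_pos.2 ⟨0, h0⟩).ne'
  set i := S.orderEmbOfFin hk with hidef
  have hi0 : i 0 = 0 := by
    obtain ⟨j, hj⟩ : ∃ j, i j = 0 := by
      have : (0 : ℕ) ∈ Set.range i := by rw [Finset.range_orderEmbOfFin]; exact h0
      exact this
    have := i.monotone (Fin.zero_le j)
    lia
  have hil : i (Fin.last k) = y := by
    obtain ⟨j, hj⟩ : ∃ j, i j = y := by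
      have : y ∈ Set.range i := by rw [Finset.range_orderEmbOfFin]; exact hy
      exact this
    have h1 := i.monotone (Fin.le_last j)
    have h2 := hS _ (Finset.orderEmbOfFin_mem S hk (Fin.last k))
    lia
  have hprod : ∀ ω, ∏ a ∈ S, withOrigin ξ a ω = ∏ j, withOrigin ξ (i j) ω := by
    intro ω
    conv_lhs => rw [← Finset.image_orderEmbOfFin_univ S hk]
    rw [Finset.prod_image fun a _ b _ hab => (S.orderEmbOfFin hk).injective hab]
  simp only [hprod]
  rw [h.integral_prod_withOrigin i.strictMono hi0]
  have hsm : StrictMono (Fin.snoc (α := fun _ => ℕ) i z) := by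
    rw [Fin.strictMono_iff_lt_succ]
    intro j
    rw [Fin.snoc_castSucc]
    induction j using Fin.lastCases with
    | last => rw [Fin.succ_last, Fin.snoc_last, hil]; exact hyz
    | cast j => rw [Fin.succ_castSucc, Fin.snoc_castSucc]; exact i.strictMono Fin.castSucc_lt_succ
  have h1 := h.integral_prod_withOrigin hsm (by
    rw [← Fin.castSucc_zero, Fin.snoc_castSucc]; exact hi0)
  simp only [Fin.prod_univ_castSucc, Fin.snoc_castSucc, Fin.snoc_last, Fin.succ_last,
    Fin.succ_castSucc, hil] at h1
  simp only [Fin.prod_univ_castSucc]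
  simpa [hil] using h1

theorem mem_closure_eq_prod (h : IsGBPStar f P ξ) {y : ℕ} {Y : Ω → ℝ}
    (hY : Y ∈ Submonoid.closure (withOrigin ξ '' Set.Iio y)) :
    ∃ A : Finset ℕ, (∀ a ∈ A, a < y) ∧ ∀ ω, Y ω = ∏ a ∈ A, withOrigin ξ a ω := by
  induction hY using Submonoid.closure_induction with
  | mem x hx =>
    obtain ⟨a, ha, rfl⟩ := hx
    exact ⟨{a}, by simpa using ha, by simp⟩
  | one => exact ⟨∅, by simp, by simp⟩
  | mul x x' _ _ hx hx' =>
    obtain ⟨A, hA, hA'⟩ := hx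
    obtain ⟨B, hB, hB'⟩ := hx'
    refine ⟨A ∪ B, fun a ha => (Finset.mem_union.1 ha).elim (hA a) (hB a), fun ω => ?_⟩
    rw [Pi.mul_apply, hA', hB', Finset.prod_mul_prod_of_binary _ _ fun i => h.withOrigin_binary i ω]

/-- The renewal property at a site carrying a one. -/
theorem integral_mul_withOrigin_mul [IsProbabilityMeasure P] (h : IsGBPStar f P ξ) {y z : ℕ} (hyz : y < z) {Y : Ω → ℝ}
    (hY : Y ∈ pastAlgebra (withOrigin ξ) y) :
    ∫ ω, Y ω * withOrigin ξ y ω * withOrigin ξ z ω ∂P =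
      (∫ ω, Y ω * withOrigin ξ y ω ∂P) * f (z - y) := by
  have hint : ∀ {Y : Ω → ℝ}, Y ∈ pastAlgebra (withOrigin ξ) y →
      Integrable (fun ω => Y ω * withOrigin ξ y ω * withOrigin ξ z ω) P ∧
      Integrable (fun ω => Y ω * withOrigin ξ y ω) P := fun {Y} hY => by
    have h1 : Y * withOrigin ξ y ∈ pastAlgebra (withOrigin ξ) (z + 1) :=
      mul_mem (pastAlgebra_mono _ (by lia) hY) (mem_pastAlgebra _ (by lia))
    exact ⟨h.integrable_of_mem (mul_mem h1 (mem_pastAlgebra _ (Nat.lt_succ_self z))),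
      h.integrable_of_mem h1⟩
  -- By linearity it suffices to treat monomials, which for binary variables are products over
  -- finite sets of sites.
  have hY' : Y ∈ Submodule.span ℝ (Submonoid.closure (withOrigin ξ '' Set.Iio y) : Set (Ω → ℝ)) := by
    rw [← Algebra.adjoin_eq_span]; exact hY
  have hmem : ∀ {x : Ω → ℝ}, x ∈ Submodule.span ℝ
      (Submonoid.closure (withOrigin ξ '' Set.Iio y) : Set (Ω → ℝ)) →
      x ∈ pastAlgebra (withOrigin ξ) y := by
    intro x hx
    rw [← Algebra.adjoin_eq_span] at hx
    exact hx
  clear hY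
  induction hY' using Submodule.span_induction with
  | mem x hx =>
    obtain ⟨A, hA, hAx⟩ := h.mem_closure_eq_prod hx
    -- The origin carries the value `1`, so inserting it changes nothing while making the chain
    -- start at `0`.
    have h1 : ∀ ω, x ω * withOrigin ξ y ω = ∏ a ∈ A ∪ {0, y}, withOrigin ξ a ω := by
      intro ω
      rw [← Finset.prod_mul_prod_of_binary _ _ fun i => h.withOrigin_binary i ω, hAx]
      congr 1
      by_cases hy : y = 0
      · simp [hy]
      · rw [Finset.prod_pair (Ne.symm hy)]; simp
    simp only [h1]
    refine h.integral_prod_mul_withOrigin (by simp) (by simp) ?_ hyz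
    intro a ha
    simp only [Finset.mem_union, Finset.mem_insert, Finset.mem_singleton] at ha
    rcases ha with ha | rfl | rfl
    · exact (hA a ha).le
    · exact Nat.zero_le _
    · exact le_rfl
  | zero => simp
  | add u v hu hv hu' hv' =>
    simp only [Pi.add_apply, add_mul]
    rw [integral_add (hint (hmem hu)).1 (hint (hmem hv)).1,
      integral_add (hint (hmem hu)).2 (hint (hmem hv)).2, hu', hv', add_mul]
  | smul r u hu hu' =>
    simp only [Pi.smul_apply, smul_eq_mul, mul_assoc, integral_const_mul] at hu' ⊢
    rw [hu']

end IsGBPStar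

/-! ### Falling factorials of counts of ones. -/

theorem prod_range_add_sub_of_binary (x e : ℝ) (he : e = 0 ∨ e = 1) (k : ℕ) :
    ∏ j ∈ Finset.range (k + 1), (x + e - j) =
      ∏ j ∈ Finset.range (k + 1), (x - j) + (k + 1) * (e * ∏ j ∈ Finset.range k, (x - j)) := by
  rcases he with rfl | rfl
  · simp
  · rw [Finset.prod_range_succ', Finset.prod_range_succ (fun j : ℕ => x - j)]
    have : ∀ j : ℕ, x + 1 - ((j + 1 : ℕ) : ℝ) = x - j := fun j => by push_cast; ring
    simp only [this]
    push_cast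
    ring

/-- The falling factorial of order `k` of the number of ones on the sites `(p, q]`. -/
noncomputable def fallingCount {Ω : Type*} (η : ℕ → Ω → ℝ) (p q k : ℕ) (ω : Ω) : ℝ :=
  ∏ j ∈ Finset.range k, (∑ y ∈ Finset.Ioc p q, η y ω - j)

@[simp]
theorem fallingCount_zero {Ω : Type*} (η : ℕ → Ω → ℝ) (p q : ℕ) : fallingCount η p q 0 = 1 := by
  ext; simp [fallingCount]

theorem fallingCount_mem {Ω : Type*} (η : ℕ → Ω → ℝ) (p q k : ℕ) :
    fallingCount η p q k ∈ pastAlgebra η (q + 1) := by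
  have : fallingCount η p q k =
      ∏ j ∈ Finset.range k, (∑ y ∈ Finset.Ioc p q, η y - algebraMap ℝ (Ω → ℝ) j) := by
    ext ω
    simp [fallingCount, Finset.prod_apply]
  rw [this]
  refine prod_mem fun j _ => sub_mem (sum_mem fun y hy => mem_pastAlgebra η ?_)
    (Subalgebra.algebraMap_mem _ _)
  have := (Finset.mem_Ioc.1 hy).2
  lia

/-- The left side is `(k+1)!` times the number of `(k+1)`-subsets of the ones; these are sorted by
their largest element `z`. -/
theorem fallingCount_succ {Ω : Type*} {η : ℕ → Ω → ℝ} (hη : ∀ i ω, η i ω = 0 ∨ η i ω = 1)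
    (p q k : ℕ) (ω : Ω) :
    fallingCount η p q (k + 1) ω =
      (k + 1) * ∑ z ∈ Finset.Ioc p q, η z ω * fallingCount η p (z - 1) k ω := by
  induction q with
  | zero => simp [fallingCount, Finset.prod_range_succ']
  | succ q ih =>
    rcases Nat.lt_or_ge q p with h | h
    · have : Finset.Ioc p (q + 1) = ∅ := Finset.Ioc_eq_empty (by lia)
      simp [fallingCount, this, Finset.prod_range_succ']
    · have hI : Finset.Ioc p (q + 1) = insert (q + 1) (Finset.Ioc p q) :=
        (Finset.insert_Ioc_right_eq_Ioc_add_one h).symm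
      have hs : ∀ g : ℕ → ℝ, ∑ z ∈ Finset.Ioc p (q + 1), g z = ∑ z ∈ Finset.Ioc p q, g z + g (q + 1) :=
        fun g => by rw [hI, Finset.sum_insert (by simp), add_comm]
      rw [fallingCount, hs, hs, prod_range_add_sub_of_binary _ _ (hη _ _), mul_add, ← ih]
      rfl

theorem fallingCount_nonneg {Ω : Type*} {η : ℕ → Ω → ℝ} (hη : ∀ i ω, η i ω = 0 ∨ η i ω = 1)
    (p q k : ℕ) (ω : Ω) : 0 ≤ fallingCount η p q k ω := by
  induction k generalizing q with
  | zero => simp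
  | succ k ih =>
    rw [fallingCount_succ hη]
    refine mul_nonneg (by positivity) (Finset.sum_nonneg fun z _ => mul_nonneg ?_ (ih _))
    rcases hη z ω with h | h <;> simp [h]

/-- Single factors may be negative, so the comparison is not factorwise: it rests on nonnegativity
of the shorter falling factorial. -/
theorem fallingCount_le_pow {Ω : Type*} {η : ℕ → Ω → ℝ} (hη : ∀ i ω, η i ω = 0 ∨ η i ω = 1)
    (p q k : ℕ) (ω : Ω) : fallingCount η p q k ω ≤ (∑ y ∈ Finset.Ioc p q, η y ω) ^ k := by
  have hW : 0 ≤ ∑ y ∈ Finset.Ioc p q, η y ω := Finset.sum_nonneg fun z _ => by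
    rcases hη z ω with h | h <;> simp [h]
  induction k with
  | zero => simp
  | succ k ih =>
    have h0 := fallingCount_nonneg hη p q k ω
    have : fallingCount η p q (k + 1) ω =
        fallingCount η p q k ω * (∑ y ∈ Finset.Ioc p q, η y ω - k) := by
      rw [fallingCount, Finset.prod_range_succ]; rfl
    rw [this, pow_succ]
    refine (mul_le_mul_of_nonneg_left (sub_le_self _ (Nat.cast_nonneg k)) h0).trans ?_
    gcongr

/-- Either the count `W` is at most `2k`, or every factor `W - j` with `j < k` is at least `W / 2`.
-/
theorem pow_le_add_fallingCount {Ω : Type*} {η : ℕ → Ω → ℝ} (hη : ∀ i ω, η i ω = 0 ∨ η i ω = 1)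
    (p q k : ℕ) (ω : Ω) :
    (∑ y ∈ Finset.Ioc p q, η y ω) ^ k ≤ (2 * k) ^ k + 2 ^ k * fallingCount η p q k ω := by
  set W := ∑ y ∈ Finset.Ioc p q, η y ω with hWdef
  have hW : 0 ≤ W := Finset.sum_nonneg fun z _ => by
    rcases hη z ω with h | h <;> simp [h]
  have h0 := fallingCount_nonneg hη p q k ω
  rcases le_total W (2 * k) with h | h
  · have : W ^ k ≤ (2 * k) ^ k := by gcongr
    have : 0 ≤ 2 ^ k * fallingCount η p q k ω := by positivity
    linarith
  · have h1 : (W / 2) ^ k ≤ fallingCount η p q k ω := by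
      rw [fallingCount, ← hWdef]
      calc (W / 2) ^ k = ∏ _j ∈ Finset.range k, W / 2 := by rw [Finset.prod_const, Finset.card_range]
        _ ≤ _ := by
          refine Finset.prod_le_prod (fun _ _ => by positivity) fun j hj => ?_
          have : (j : ℝ) < k := by exact_mod_cast Finset.mem_range.1 hj
          linarith
    have h2 : W ^ k = 2 ^ k * (W / 2) ^ k := by rw [← mul_pow]; congr 1; ring
    rw [h2]
    have : (0 : ℝ) ≤ (2 * k) ^ k := by positivity
    have := mul_le_mul_of_nonneg_left h1 (show (0 : ℝ) ≤ 2 ^ k by positivity)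
    linarith

/-- `Y` is a sum over `y ∈ [p, q]` of nonnegative functions of the sites before `y`, each switched
on by a one at `y`. -/
def LastOneIn {Ω : Type*} (η : ℕ → Ω → ℝ) (p q : ℕ) (Y : Ω → ℝ) : Prop :=
  ∃ Y' : ℕ → Ω → ℝ, (∀ y, Y' y ∈ pastAlgebra η y) ∧ (∀ y ω, 0 ≤ Y' y ω) ∧
    ∀ ω, Y ω = ∑ y ∈ Finset.Icc p q, Y' y ω * η y ω

theorem LastOneIn.mem {Ω : Type*} {η : ℕ → Ω → ℝ} {p q : ℕ} {Y : Ω → ℝ} (h : LastOneIn η p q Y) :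
    Y ∈ pastAlgebra η (q + 1) := by
  obtain ⟨Y', h1, -, h3⟩ := h
  have : Y = ∑ y ∈ Finset.Icc p q, Y' y * η y := by ext ω; simp [h3, Finset.sum_apply]
  rw [this]
  refine sum_mem fun y hy => ?_
  have := (Finset.mem_Icc.1 hy).2
  exact mul_mem (pastAlgebra_mono η (by lia) (h1 y)) (mem_pastAlgebra η (by lia))

theorem LastOneIn.mul_fallingCount {Ω : Type*} {η : ℕ → Ω → ℝ}
    (hη : ∀ i ω, η i ω = 0 ∨ η i ω = 1) {p q r : ℕ} (s : ℕ) {Y : Ω → ℝ}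
    (h : LastOneIn η p q Y) (hqr : q ≤ r) (k : ℕ) :
    LastOneIn η r s (fun ω => Y ω * fallingCount η r s (k + 1) ω) := by
  have hη0 : ∀ i ω, 0 ≤ η i ω := fun i ω => by rcases hη i ω with h | h <;> simp [h]
  have hY0 : ∀ ω, 0 ≤ Y ω := by
    obtain ⟨Y', -, h2, h3⟩ := h
    intro ω
    rw [h3]
    exact Finset.sum_nonneg fun y _ => mul_nonneg (h2 _ _) (hη0 _ _)
  -- The window `(r, s]` excludes `r`, whereas `LastOneIn` uses a closed range; the extra summand is
  -- set to zero.
  refine ⟨fun y => if r < y then (k + 1 : ℝ) • (Y * fallingCount η r (y - 1) k) else 0,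
    fun y => ?_, fun y ω => ?_, fun ω => ?_⟩
  · dsimp only
    split_ifs with hy
    · refine Subalgebra.smul_mem _ (mul_mem (pastAlgebra_mono η (by lia) h.mem) ?_) _
      have := fallingCount_mem η r (y - 1) k
      rwa [Nat.sub_add_cancel (by lia)] at this
    · exact zero_mem _
  · dsimp only
    split_ifs with hy
    · have := fallingCount_nonneg hη r (y - 1) k ω
      have := hY0 ω
      simp only [Pi.smul_apply, Pi.mul_apply, smul_eq_mul]
      positivity
    · simp
  · dsimp only
    rw [fallingCount_succ hη, Finset.mul_sum, Finset.mul_sum]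
    refine (Finset.sum_congr rfl fun z hz => ?_).trans
      (Finset.sum_subset Finset.Ioc_subset_Icc_self fun z hz hz' => ?_)
    · rw [if_pos (Finset.mem_Ioc.1 hz).1]
      simp only [Pi.smul_apply, Pi.mul_apply, smul_eq_mul]
      ring
    · rw [if_neg]
      · simp
      · simp only [Finset.mem_Icc, Finset.mem_Ioc] at hz hz'
        lia

/-! ### Bounds for factorial moments over successive windows. -/

namespace IsGBPStar

variable {f : ℕ → ℝ} {Ω : Type*} [MeasurableSpace Ω] {P : Measure Ω} {ξ : ℕ → Ω → ℝ}

theorem integrable_mul_fallingCount_mul [IsProbabilityMeasure P] (h : IsGBPStar f P ξ) {a : ℕ}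
    {Y : Ω → ℝ} (hY : Y ∈ pastAlgebra (withOrigin ξ) a) (r s k z : ℕ) :
    Integrable (fun ω => Y ω * fallingCount (withOrigin ξ) r s k ω * withOrigin ξ z ω) P := by
  refine h.integrable_of_mem (y := a + s + z + 1) (mul_mem (mul_mem
    (pastAlgebra_mono _ (by lia) hY)
    (pastAlgebra_mono _ (by lia) (fallingCount_mem (withOrigin ξ) r s k)))
    (mem_pastAlgebra _ (y := z) (by lia)))

theorem integral_mul_fallingCount_succ [IsProbabilityMeasure P] (h : IsGBPStar f P ξ) {q r : ℕ}
    {Y : Ω → ℝ} (hY : Y ∈ pastAlgebra (withOrigin ξ) (q + 1)) (s k : ℕ) :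
    ∫ ω, Y ω * fallingCount (withOrigin ξ) r s (k + 1) ω ∂P =
      (k + 1) * ∑ z ∈ Finset.Ioc r s,
        ∫ ω, Y ω * fallingCount (withOrigin ξ) r (z - 1) k ω * withOrigin ξ z ω ∂P := by
  rw [← integral_finsetSum _ fun z _ => h.integrable_mul_fallingCount_mul hY _ _ _ _,
    ← integral_const_mul]
  congr 1
  ext ω
  rw [fallingCount_succ h.withOrigin_binary, Finset.mul_sum, Finset.mul_sum, Finset.mul_sum]
  exact Finset.sum_congr rfl fun z _ => by ring

/-- The chain is split at its last one `y` before `z`, where the renewal property releases the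
factor `f (z - y)`. This is the recursion that defines `gapSum`. -/
theorem integral_mul_fallingCount_succ_mul [IsProbabilityMeasure P] (h : IsGBPStar f P ξ)
    {q r : ℕ} (hqr : q ≤ r) {Y : Ω → ℝ} (hY : Y ∈ pastAlgebra (withOrigin ξ) (q + 1)) (k z : ℕ)
    (hz : 0 < z) :
    ∫ ω, Y ω * fallingCount (withOrigin ξ) r (z - 1) (k + 1) ω * withOrigin ξ z ω ∂P =
      (k + 1) * ∑ y ∈ Finset.Ioc r (z - 1),
        (∫ ω, Y ω * fallingCount (withOrigin ξ) r (y - 1) k ω * withOrigin ξ y ω ∂P) * f (z - y) := by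
  have hmem : ∀ y ∈ Finset.Ioc r (z - 1),
      Y * fallingCount (withOrigin ξ) r (y - 1) k ∈ pastAlgebra (withOrigin ξ) y := by
    intro y hy
    have := (Finset.mem_Ioc.1 hy).1
    refine mul_mem (pastAlgebra_mono _ (by lia) hY) ?_
    have := fallingCount_mem (withOrigin ξ) r (y - 1) k
    rwa [Nat.sub_add_cancel (by lia)] at this
  have hren : ∀ y ∈ Finset.Ioc r (z - 1), (∫ ω, Y ω * fallingCount (withOrigin ξ) r (y - 1) k ω *
      withOrigin ξ y ω ∂P) * f (z - y) = ∫ ω, Y ω * fallingCount (withOrigin ξ) r (y - 1) k ω *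
      withOrigin ξ y ω * withOrigin ξ z ω ∂P := by
    intro y hy
    have := Finset.mem_Ioc.1 hy
    exact (h.integral_mul_withOrigin_mul (by lia) (hmem y hy)).symm
  rw [Finset.sum_congr rfl hren, ← integral_finsetSum, ← integral_const_mul]
  · congr 1
    ext ω
    rw [fallingCount_succ h.withOrigin_binary, Finset.mul_sum, Finset.mul_sum, Finset.mul_sum,
      Finset.sum_mul]
    exact Finset.sum_congr rfl fun z _ => by ring
  · intro y hy
    have := Finset.mem_Ioc.1 hy
    exact h.integrable_of_mem (y := z + 1) (mul_mem (mul_mem (pastAlgebra_mono _ (by lia)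
      (hmem y hy)) (mem_pastAlgebra _ (by lia))) (mem_pastAlgebra _ (by lia)))

/-- Factorial moments of the number of ones among the first `N` sites. -/
theorem integral_fallingCount_le [IsProbabilityMeasure P] (h : IsGBPStar f P ξ)
    (hf : ∀ x, 0 ≤ f x) (N k : ℕ) :
    ∫ ω, fallingCount (withOrigin ξ) 0 N k ω ∂P ≤ k.factorial * (∑ x ∈ Finset.Icc 1 N, f x) ^ k := by
  set F := ∑ x ∈ Finset.Icc 1 N, f x with hF
  have hF0 : 0 ≤ F := Finset.sum_nonneg fun x _ => hf x
  have h1 : (fun _ => 1 : Ω → ℝ) ∈ pastAlgebra (withOrigin ξ) (0 + 1) := one_mem _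
  let e : ℕ → ℕ → ℝ := fun k z =>
    ∫ ω, 1 * fallingCount (withOrigin ξ) 0 (z - 1) k ω * withOrigin ξ z ω ∂P
  have he0 : ∀ k z, 0 ≤ e k z := fun k z => integral_nonneg fun ω => by
    have := fallingCount_nonneg h.withOrigin_binary 0 (z - 1) k ω
    have := h.withOrigin_nonneg z ω
    positivity
  have hsum : ∀ k, ∑ z ∈ Finset.Ioc 0 N, e k z ≤ k.factorial * F ^ (k + 1) := by
    intro k
    induction k with
    | zero =>
      refine le_of_eq ?_
      simp only [Nat.factorial_zero, Nat.cast_one, one_mul, zero_add, pow_one, hF, e,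
        fallingCount_zero, Pi.one_apply]
      refine Finset.sum_congr rfl fun z hz => ?_
      have := h.integral_mul_withOrigin_mul (Finset.mem_Ioc.1 hz).1 (one_mem _)
      simpa using this
    | succ k ih =>
      have hrec : ∀ z ∈ Finset.Ioc 0 N, e (k + 1) z =
          (k + 1) * ∑ y ∈ Finset.Ioc 0 (z - 1), e k y * f (z - y) := fun z hz =>
        h.integral_mul_fallingCount_succ_mul le_rfl h1 k z (Finset.mem_Ioc.1 hz).1
      rw [Finset.sum_congr rfl hrec, ← Finset.mul_sum,
        Finset.sum_comm' (t' := Finset.Ioc 0 N) (s' := fun y => Finset.Ioc y N)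
          (by intro x y; simp only [Finset.mem_Ioc]; lia)]
      -- For fixed `y` the gaps `z - y` are distinct elements of `[1, N]`.
      have hin : ∀ y ∈ Finset.Ioc 0 N, ∑ z ∈ Finset.Ioc y N, e k y * f (z - y) ≤ e k y * F := by
        intro y hy
        rw [← Finset.mul_sum]
        refine mul_le_mul_of_nonneg_left ?_ (he0 k y)
        rw [hF, ← Finset.sum_image (g := fun z => z - y) (f := f)]
        · refine Finset.sum_le_sum_of_subset_of_nonneg ?_ fun x _ _ => hf x
          intro x hx
          simp only [Finset.mem_image, Finset.mem_Ioc, Finset.mem_Icc] at hx ⊢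
          lia
        · intro a ha b hb hab
          simp only [Finset.coe_Ioc, Set.mem_Ioc] at ha hb hab
          lia
      calc (k + 1 : ℝ) * ∑ y ∈ Finset.Ioc 0 N, ∑ z ∈ Finset.Ioc y N, e k y * f (z - y)
          ≤ (k + 1 : ℝ) * ((∑ y ∈ Finset.Ioc 0 N, e k y) * F) := by
            rw [Finset.sum_mul]
            exact mul_le_mul_of_nonneg_left (Finset.sum_le_sum hin) (by positivity)
        _ ≤ (k + 1 : ℝ) * ((k.factorial * F ^ (k + 1)) * F) := by gcongr
        _ = _ := by rw [Nat.factorial_succ]; push_cast; ring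
  cases k with
  | zero => simp
  | succ k =>
    have h2 := h.integral_mul_fallingCount_succ (r := 0) h1 N k
    simp only [one_mul] at h2
    rw [h2, Nat.factorial_succ]
    push_cast
    rw [mul_assoc]
    refine mul_le_mul_of_nonneg_left ?_ (by positivity)
    simpa only [e, one_mul] using hsum k

/-- Gaps after `r` are summed exactly by `gapSum`. Only the entry gap, from the last one in `[p, q]`
to the first chosen one in `(r, s]`, is estimated: its length lies in `[r + 1 - q, s - p]` and `f`
is decreasing. -/
theorem integral_mul_fallingCount_mul_bounds [IsProbabilityMeasure P] (h : IsGBPStar f P ξ)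
    (hf : ∀ x, 0 ≤ f x) (hanti : ∀ a b, 1 ≤ a → a ≤ b → f b ≤ f a) {p q r s : ℕ} {Y : Ω → ℝ}
    (hY : LastOneIn (withOrigin ξ) p q Y) (hqr : q ≤ r) (k z : ℕ) (hrz : r < z) (hzs : z ≤ s) :
    (∫ ω, Y ω ∂P) * f (s - p) * (k.factorial * gapSum f k (z - r)) ≤
      ∫ ω, Y ω * fallingCount (withOrigin ξ) r (z - 1) k ω * withOrigin ξ z ω ∂P ∧
    ∫ ω, Y ω * fallingCount (withOrigin ξ) r (z - 1) k ω * withOrigin ξ z ω ∂P ≤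
      (∫ ω, Y ω ∂P) * f (r + 1 - q) * (k.factorial * gapSum f k (z - r)) := by
  induction k generalizing z with
  | zero =>
    simp only [fallingCount_zero, Pi.one_apply, mul_one, Nat.factorial_zero, Nat.cast_one, gapSum]
    obtain ⟨Y', h1, h2, h3⟩ := hY
    have hi : ∀ y ∈ Finset.Icc p q, Integrable (fun ω => Y' y ω * withOrigin ξ y ω) P := fun y _ =>
      h.integrable_of_mem (y := y + 1) (mul_mem (pastAlgebra_mono _ (by lia) (h1 y))
        (mem_pastAlgebra _ (by lia)))
    have hi2 : ∀ y ∈ Finset.Icc p q,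
        Integrable (fun ω => Y' y ω * withOrigin ξ y ω * withOrigin ξ z ω) P := fun y _ =>
      h.integrable_of_mem (y := y + z + 1) (mul_mem (mul_mem (pastAlgebra_mono _ (by lia) (h1 y))
        (mem_pastAlgebra _ (by lia))) (mem_pastAlgebra _ (by lia)))
    simp only [h3, Finset.sum_mul]
    rw [integral_finsetSum _ hi, integral_finsetSum _ hi2, Finset.sum_mul, Finset.sum_mul]
    have hnn : ∀ y, 0 ≤ ∫ ω, Y' y ω * withOrigin ξ y ω ∂P := fun y =>
      integral_nonneg fun ω => mul_nonneg (h2 y ω) (h.withOrigin_nonneg y ω)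
    constructor
    all_goals
      refine Finset.sum_le_sum fun y hy => ?_
      obtain ⟨hy1, hy2⟩ := Finset.mem_Icc.1 hy
      rw [h.integral_mul_withOrigin_mul (by lia) (h1 y)]
      exact mul_le_mul_of_nonneg_left (hanti _ _ (by lia) (by lia)) (hnn y)
  | succ k ih =>
    rw [h.integral_mul_fallingCount_succ_mul hqr hY.mem k z (by lia)]
    have hgap : gapSum f (k + 1) (z - r) =
        ∑ y ∈ Finset.Ioc r (z - 1), gapSum f k (y - r) * f (z - y) := by
      rw [gapSum]
      refine (Finset.sum_nbij' (fun y => y - r) (fun x => x + r) ?_ ?_ ?_ ?_ ?_).symm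
      · intro y hy; simp only [Finset.mem_Ioc, Finset.mem_Ico] at hy ⊢; lia
      · intro y hy; simp only [Finset.mem_Ioc, Finset.mem_Ico] at hy ⊢; lia
      · intro y hy; simp only [Finset.mem_Ioc] at hy; lia
      · intro y hy; simp
      · intro y hy
        simp only [Finset.mem_Ioc] at hy
        rw [show z - r - (y - r) = z - y by lia]
    rw [hgap, Nat.factorial_succ]
    have hb : ∀ B : ℝ, B * (((k + 1) * k.factorial : ℕ) *
        ∑ y ∈ Finset.Ioc r (z - 1), gapSum f k (y - r) * f (z - y)) =
        (k + 1) * ∑ y ∈ Finset.Ioc r (z - 1),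
          B * (k.factorial * gapSum f k (y - r)) * f (z - y) := by
      intro B
      rw [Finset.mul_sum, Finset.mul_sum, Finset.mul_sum]
      exact Finset.sum_congr rfl fun y _ => by push_cast; ring
    rw [hb, hb]
    constructor
    all_goals
      refine mul_le_mul_of_nonneg_left (Finset.sum_le_sum fun y hy => ?_) (by positivity)
      obtain ⟨hy1, hy2⟩ := Finset.mem_Ioc.1 hy
    · exact mul_le_mul_of_nonneg_right (ih y hy1 (by lia)).1 (hf _)
    · exact mul_le_mul_of_nonneg_right (ih y hy1 (by lia)).2 (hf _)

theorem integral_mul_fallingCount_bounds [IsProbabilityMeasure P] (h : IsGBPStar f P ξ)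
    (hf : ∀ x, 0 ≤ f x) (hanti : ∀ a b, 1 ≤ a → a ≤ b → f b ≤ f a) {p q r : ℕ} (s : ℕ)
    {Y : Ω → ℝ} (hY : LastOneIn (withOrigin ξ) p q Y) (hqr : q ≤ r) (k : ℕ) :
    (∫ ω, Y ω ∂P) * (f (s - p) * ((k + 1).factorial * gapTotal f k (s - r))) ≤
      ∫ ω, Y ω * fallingCount (withOrigin ξ) r s (k + 1) ω ∂P ∧
    ∫ ω, Y ω * fallingCount (withOrigin ξ) r s (k + 1) ω ∂P ≤
      (∫ ω, Y ω ∂P) * (f (r + 1 - q) * ((k + 1).factorial * gapTotal f k (s - r))) := by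
  rw [h.integral_mul_fallingCount_succ hY.mem]
  have hgap : gapTotal f k (s - r) = ∑ z ∈ Finset.Ioc r s, gapSum f k (z - r) := by
    rw [gapTotal]
    refine (Finset.sum_nbij' (fun y => y - r) (fun x => x + r) ?_ ?_ ?_ ?_ ?_).symm
    · intro y hy; simp only [Finset.mem_Ioc, Finset.mem_Icc] at hy ⊢; lia
    · intro y hy; simp only [Finset.mem_Ioc, Finset.mem_Icc] at hy ⊢; lia
    · intro y hy; simp only [Finset.mem_Ioc] at hy; lia
    · intro y hy; simp
    · intro y hy; rfl
  have hb : ∀ B : ℝ, (∫ ω, Y ω ∂P) * (B * (((k + 1).factorial : ℕ) *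
      ∑ z ∈ Finset.Ioc r s, gapSum f k (z - r))) =
      (k + 1) * ∑ z ∈ Finset.Ioc r s, (∫ ω, Y ω ∂P) * B * (k.factorial * gapSum f k (z - r)) := by
    intro B
    rw [Finset.mul_sum, Finset.mul_sum, Finset.mul_sum, Finset.mul_sum, Nat.factorial_succ]
    exact Finset.sum_congr rfl fun y _ => by push_cast; ring
  rw [hgap, hb, hb]
  constructor
  all_goals
    refine mul_le_mul_of_nonneg_left (Finset.sum_le_sum fun z hz => ?_) (by positivity)
    obtain ⟨hz1, hz2⟩ := Finset.mem_Ioc.1 hz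
  · exact (h.integral_mul_fallingCount_mul_bounds hf hanti hY hqr k z hz1 hz2).1
  · exact (h.integral_mul_fallingCount_mul_bounds hf hanti hY hqr k z hz1 hz2).2

/-- Two-sided bounds for the mixed factorial moments of the numbers of ones in successive
windows `(p_j, q_j]`. -/
theorem integral_prod_fallingCount_bounds [IsProbabilityMeasure P] (h : IsGBPStar f P ξ)
    (hf : ∀ x, 0 ≤ f x) (hanti : ∀ a b, 1 ≤ a → a ≤ b → f b ≤ f a) {m : ℕ}
    (p q : Fin (m + 1) → ℕ) (κ : Fin m → ℕ) (hp0 : p 0 = 0) (hq0 : q 0 = 0)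
    (hqp : ∀ j : Fin m, q j.castSucc ≤ p j.succ) :
    LastOneIn (withOrigin ξ) (p (Fin.last m)) (q (Fin.last m))
      (fun ω => ∏ j : Fin m, fallingCount (withOrigin ξ) (p j.succ) (q j.succ) (κ j + 1) ω) ∧
    ∏ j : Fin m, (f (q j.succ - p j.castSucc) *
        ((κ j + 1).factorial * gapTotal f (κ j) (q j.succ - p j.succ))) ≤
      ∫ ω, ∏ j : Fin m, fallingCount (withOrigin ξ) (p j.succ) (q j.succ) (κ j + 1) ω ∂P ∧
    ∫ ω, ∏ j : Fin m, fallingCount (withOrigin ξ) (p j.succ) (q j.succ) (κ j + 1) ω ∂P ≤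
      ∏ j : Fin m, (f (p j.succ + 1 - q j.castSucc) *
        ((κ j + 1).factorial * gapTotal f (κ j) (q j.succ - p j.succ))) := by
  induction m with
  | zero =>
    -- The empty product is switched on by the one at the origin, which acts as a window `[0, 0]`.
    refine ⟨⟨fun _ => 1, fun y => one_mem _, fun y ω => zero_le_one, fun ω => ?_⟩, ?_, ?_⟩
    · simp [hp0, hq0]
    · simp
    · simp
  | succ m ih =>
    obtain ⟨h1, h2, h3⟩ := ih (fun j => p j.castSucc) (fun j => q j.castSucc)
      (fun j => κ j.castSucc) hp0 hq0 (fun j => hqp j.castSucc)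
    have hqr := hqp (Fin.last m)
    have hg := gapTotal_nonneg hf (κ (Fin.last m))
      (q (Fin.last m).succ - p (Fin.last m).succ)
    obtain ⟨h4, h5⟩ := h.integral_mul_fallingCount_bounds hf hanti (q (Fin.last m).succ) h1 hqr
      (κ (Fin.last m))
    simp only [Fin.prod_univ_castSucc (n := m)]
    refine ⟨?_, ?_, ?_⟩
    · exact h1.mul_fallingCount h.withOrigin_binary _ hqr _
    · refine le_trans ?_ h4
      exact mul_le_mul_of_nonneg_right h2 (mul_nonneg (hf _) (by positivity))
    · refine h5.trans ?_
      exact mul_le_mul_of_nonneg_right h3 (mul_nonneg (hf _) (by positivity))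

end IsGBPStar

/-! ### Scaling limits and uniform moment bounds. -/

theorem mul_rpow_nonneg {α c : ℝ} (hc : 0 ≤ c) (x : ℕ) : 0 ≤ c * (x : ℝ) ^ (α - 1) := by positivity

theorem mul_rpow_antitone {α c : ℝ} (hc : 0 ≤ c) (hα1 : α ≤ 1) (a b : ℕ) (ha : 1 ≤ a)
    (hab : a ≤ b) : c * (b : ℝ) ^ (α - 1) ≤ c * (a : ℝ) ^ (α - 1) := by
  have : (0 : ℝ) < a := by exact_mod_cast ha
  exact mul_le_mul_of_nonneg_left (Real.rpow_le_rpow_of_nonpos this (by exact_mod_cast hab)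
    (by linarith)) hc

/-- Read backwards, the sum is `gapSum` of order one at `N + 1`, and a convergent sequence is
bounded. -/
theorem exists_sum_rpow_le {α c : ℝ} (hα0 : 0 < α) (hα1 : α ≤ 1) :
    ∃ C, 0 ≤ C ∧ ∀ N : ℕ, ∑ x ∈ Finset.Icc 1 N, c * (x : ℝ) ^ (α - 1) ≤ C * ((N : ℝ) + 1) ^ α := by
  have h := tendsto_gapSum (c := c) hα0 hα1 1
  obtain ⟨C, hC⟩ := (Metric.isBounded_range_of_tendsto _ h).exists_norm_le
  refine ⟨C, (norm_nonneg _).trans (hC _ ⟨0, rfl⟩), fun N => ?_⟩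
  have h1 := (le_abs_self _).trans (hC _ ⟨N + 1, rfl⟩)
  have hN : (0 : ℝ) < ((N + 1 : ℕ) : ℝ) ^ (((1 : ℕ) : ℝ) * α) :=
    Real.rpow_pos_of_pos (by positivity) _
  rw [div_le_iff₀ hN] at h1
  rw [Nat.cast_one, one_mul] at h1
  push_cast at h1
  refine le_trans (le_of_eq ?_) h1
  simp only [gapSum, one_mul]
  refine Finset.sum_nbij' (fun y => N + 1 - y) (fun y => N + 1 - y) ?_ ?_ ?_ ?_ ?_
  all_goals
    intro y hy
    simp only [Finset.mem_Icc, Finset.mem_Ico] at hy ⊢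
  · lia
  · lia
  · lia
  · lia
  · rw [show N + 1 - (N + 1 - y) = y by lia]

/-- Negative `a` is needed for `t_0 - d = -d`, where the natural floor is `0`. -/
theorem tendsto_floor_mul_div (a : ℝ) :
    Tendsto (fun n : ℕ => (⌊(n : ℝ) * a⌋₊ : ℝ) / n) atTop (𝓝 (max a 0)) := by
  rcases le_total 0 a with ha | ha
  · rw [max_eq_left ha]
    refine ((tendsto_nat_floor_mul_div_atTop ha).comp tendsto_natCast_atTop_atTop).congr fun n => ?_
    simp [mul_comm]
  · rw [max_eq_right ha]
    refine tendsto_const_nhds.congr fun n => ?_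
    rw [Nat.floor_of_nonpos (mul_nonpos_of_nonneg_of_nonpos (Nat.cast_nonneg n) ha)]
    simp

theorem tendsto_natCast_of_div {u : ℕ → ℕ} {ℓ : ℝ} (hℓ : 0 < ℓ)
    (hu : Tendsto (fun n : ℕ => (u n : ℝ) / n) atTop (𝓝 ℓ)) : Tendsto u atTop atTop := by
  rw [← tendsto_natCast_atTop_iff (R := ℝ)]
  refine (hu.pos_mul_atTop hℓ tendsto_natCast_atTop_atTop).congr' ?_
  filter_upwards [eventually_ge_atTop 1] with n hn
  have : (n : ℝ) ≠ 0 := by positivity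
  field_simp

/-- The scaling limit of the contribution of one window. -/
theorem tendsto_window {α c : ℝ} (hα0 : 0 < α) (hα1 : α ≤ 1) (hc : 0 < c) (k : ℕ) {u v : ℕ → ℕ}
    {ℓ d : ℝ} (hℓ : 0 < ℓ) (hd : 0 < d) (hu : Tendsto (fun n : ℕ => (u n : ℝ) / n) atTop (𝓝 ℓ))
    (hv : Tendsto (fun n : ℕ => (v n : ℝ) / n) atTop (𝓝 d)) :
    Tendsto (fun n : ℕ => (c * (u n : ℝ) ^ (α - 1) * ((k + 1).factorial *
        gapTotal (fun x => c * (x : ℝ) ^ (α - 1)) k (v n))) / ((n : ℝ) ^ α) ^ (k + 1)) atTop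
      (𝓝 ((c * Real.Gamma α) ^ (k + 1) * (d ^ (k * α + 1) * ((k + 1).factorial /
        (Real.Gamma (k * α + 2) * Real.Gamma α) * ℓ ^ (α - 1))))) := by
  have h1 := hu.rpow_const (p := α - 1) (Or.inl hℓ.ne')
  have h2 := hv.rpow_const (p := k * α + 1) (Or.inl hd.ne')
  have h3 := (tendsto_gapTotal (c := c) hα0 hα1 k).comp (tendsto_natCast_of_div hd hv)
  have h4 := ((h1.const_mul c).mul ((h2.mul h3).const_mul ((k + 1).factorial : ℝ)))
  have hΓ : Real.Gamma α ≠ 0 := (Real.Gamma_pos_of_pos hα0).ne'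
  have hΓ2 : Real.Gamma (k * α + 2) ≠ 0 := (Real.Gamma_pos_of_pos (by positivity)).ne'
  convert h4.congr' ?_ using 2
  · field_simp
    ring
  · filter_upwards [eventually_ge_atTop 1, (tendsto_natCast_of_div hd hv).eventually_ge_atTop 1]
      with n hn hvn
    have hn0 : (0 : ℝ) < n := by exact_mod_cast hn
    have hv0 : (0 : ℝ) < v n := by exact_mod_cast hvn
    simp only [Function.comp]
    -- The normalisation splits between the entry gap and the chains inside the window.
    have hpow : ((n : ℝ) ^ α) ^ (k + 1) = (n : ℝ) ^ (α - 1) * (n : ℝ) ^ (k * α + 1) := by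
      rw [← Real.rpow_natCast, ← Real.rpow_mul hn0.le, ← Real.rpow_add hn0]
      congr 1; push_cast; ring
    rw [Real.div_rpow (Nat.cast_nonneg _) hn0.le, Real.div_rpow (Nat.cast_nonneg _) hn0.le, hpow]
    have p1 := Real.rpow_pos_of_pos hn0 (α - 1)
    have p2 := Real.rpow_pos_of_pos hn0 (k * α + 1)
    have p3 := Real.rpow_pos_of_pos hv0 (k * α + 1)
    field_simp

theorem sum_Icc_eq_sum_Ioc_withOrigin {Ω : Type*} (ξ : ℕ → Ω → ℝ) (N : ℕ) (ω : Ω) :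
    ∑ i ∈ Finset.Icc 1 N, ξ i ω = ∑ y ∈ Finset.Ioc 0 N, withOrigin ξ y ω :=
  Finset.sum_congr rfl fun y hy => by
    rw [withOrigin_of_ne_zero]
    have := (Finset.mem_Icc.1 hy).1
    lia

theorem scaledWalk_sub_scaledWalk {Ω : Type*} (α : ℝ) (n : ℕ) (ξ : ℕ → Ω → ℝ) {s t : ℝ}
    (hst : s ≤ t) (ω : Ω) :
    scaledWalk α n ξ t ω - scaledWalk α n ξ s ω =
      (∑ y ∈ Finset.Ioc ⌊(n : ℝ) * s⌋₊ ⌊(n : ℝ) * t⌋₊, withOrigin ξ y ω) / (n : ℝ) ^ α := by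
  have h : ⌊(n : ℝ) * s⌋₊ ≤ ⌊(n : ℝ) * t⌋₊ := Nat.floor_mono (by gcongr)
  rw [scaledWalk, scaledWalk, sum_Icc_eq_sum_Ioc_withOrigin, sum_Icc_eq_sum_Ioc_withOrigin,
    ← Finset.sum_Ioc_consecutive _ (Nat.zero_le _) h]
  ring

namespace IsGBPStar

theorem sum_pow_integrable {f : ℕ → ℝ} {Ω : Type*} [MeasurableSpace Ω] {P : Measure Ω}
    [IsProbabilityMeasure P] {ξ : ℕ → Ω → ℝ} (h : IsGBPStar f P ξ) (p q K : ℕ) :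
    Integrable (fun ω => (∑ y ∈ Finset.Ioc p q, withOrigin ξ y ω) ^ K) P := by
  have hmem : ∑ y ∈ Finset.Ioc p q, withOrigin ξ y ∈ pastAlgebra (withOrigin ξ) (q + 1) :=
    sum_mem fun y hy => mem_pastAlgebra _ (by have := (Finset.mem_Ioc.1 hy).2; lia)
  convert h.integrable_of_mem (pow_mem hmem K) using 2 with ω
  simp

/-- The bound is uniform in `n`: powers are controlled by falling factorials, whose means are at
most `K!` times the `K`-th power of a partial sum of `f`, which is `O(n^α)`. -/
theorem exists_scaled_moment_le {α c : ℝ} (hα0 : 0 < α) (hα1 : α ≤ 1) (hc : 0 < c) {T : ℝ}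
    (hT : 0 ≤ T) (K : ℕ) :
    ∃ C, ∀ (n : ℕ) {Ω : Type} [MeasurableSpace Ω] (P : Measure Ω) [IsProbabilityMeasure P]
      (ξ : ℕ → Ω → ℝ), 1 ≤ n → IsGBPStar (fun x => c * (x : ℝ) ^ (α - 1)) P ξ →
      ∫ ω, ((∑ y ∈ Finset.Ioc 0 ⌊(n : ℝ) * T⌋₊, withOrigin ξ y ω) / (n : ℝ) ^ α) ^ K ∂P ≤ C := by
  obtain ⟨C, hC0, hC⟩ := exists_sum_rpow_le (c := c) hα0 hα1
  refine ⟨(2 * K) ^ K + 2 ^ K * (K.factorial * (C * (T + 1) ^ α) ^ K), ?_⟩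
  intro n Ω _ P _ ξ hn h
  have hn1 : (1 : ℝ) ≤ n := by exact_mod_cast hn
  have hn0 : (0 : ℝ) < n := by linarith
  have hnα : 1 ≤ (n : ℝ) ^ α := Real.one_le_rpow hn1 hα0.le
  set N := ⌊(n : ℝ) * T⌋₊
  have hN : (N : ℝ) + 1 ≤ n * (T + 1) := by
    have : (N : ℝ) ≤ n * T := Nat.floor_le (by positivity)
    nlinarith
  simp only [div_pow, integral_div]
  rw [div_le_iff₀ (by positivity)]
  have hF : ∑ x ∈ Finset.Icc 1 N, c * (x : ℝ) ^ (α - 1) ≤ C * (T + 1) ^ α * (n : ℝ) ^ α := by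
    refine (hC N).trans ?_
    rw [mul_assoc, ← Real.mul_rpow (by positivity) hn0.le, mul_comm (T + 1)]
    gcongr
  have hF0 : 0 ≤ ∑ x ∈ Finset.Icc 1 N, c * (x : ℝ) ^ (α - 1) :=
    Finset.sum_nonneg fun x _ => mul_rpow_nonneg hc.le x
  have hfi : Integrable (fallingCount (withOrigin ξ) 0 N K) P :=
    h.integrable_of_mem (fallingCount_mem _ _ _ _)
  calc ∫ ω, (∑ y ∈ Finset.Ioc 0 N, withOrigin ξ y ω) ^ K ∂P
      ≤ ∫ ω, ((2 * K) ^ K + 2 ^ K * fallingCount (withOrigin ξ) 0 N K ω) ∂P :=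
        integral_mono (h.sum_pow_integrable _ _ _) ((integrable_const _).add (hfi.const_mul _))
          fun ω => pow_le_add_fallingCount h.withOrigin_binary _ _ _ _
    _ = (2 * K) ^ K + 2 ^ K * ∫ ω, fallingCount (withOrigin ξ) 0 N K ω ∂P := by
        rw [integral_add (integrable_const _) (hfi.const_mul _), integral_const_mul]
        simp
    _ ≤ (2 * K) ^ K + 2 ^ K * (K.factorial * (C * (T + 1) ^ α * (n : ℝ) ^ α) ^ K) := by
        gcongr
        refine (h.integral_fallingCount_le (mul_rpow_nonneg hc.le) N K).trans ?_
        gcongr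
    _ = (2 * K) ^ K * 1 + 2 ^ K * (K.factorial * (C * (T + 1) ^ α) ^ K) * ((n : ℝ) ^ α) ^ K := by
        rw [mul_pow _ ((n : ℝ) ^ α)]; ring
    _ ≤ (2 * K) ^ K * ((n : ℝ) ^ α) ^ K +
          2 ^ K * (K.factorial * (C * (T + 1) ^ α) ^ K) * ((n : ℝ) ^ α) ^ K := by
        gcongr
        exact one_le_pow₀ hnα
    _ = _ := by ring

end IsGBPStar

/-! ### Moments of increments: `n → ∞`, then `d ↓ 0`. -/

section Limits

variable {Ω : Type*} [MeasurableSpace Ω] {μ : Measure Ω} [IsProbabilityMeasure μ]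
  {α c : ℝ} {X : ℝ → Ω → ℝ} {Ω' : ℕ → Type} [∀ n, MeasurableSpace (Ω' n)]
  {P : ∀ n, Measure (Ω' n)} [∀ n, IsProbabilityMeasure (P n)] {ξ : ∀ n, ℕ → Ω' n → ℝ}

/-- Mixed moments of increments of the limit are limits of mixed factorial moments of the numbers
of ones in the corresponding windows. -/
theorem integrable_and_tendsto_increments (hα0 : 0 < α) (hα1 : α < 1) (hc : 0 < c)
    (hξ : ∀ n, IsGBPStar (fun x => c * (x : ℝ) ^ (α - 1)) (P n) (ξ n))
    (hX : ∀ (m : ℕ) (t : Fin m → ℝ), (∀ i, 0 < t i) →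
      TendstoInDistribution (fun n ω (i : Fin m) => scaledWalk α n (ξ n) (t i) ω) atTop
        (fun ω (i : Fin m) => c * Real.Gamma α * X (t i) ω) P μ)
    {m : ℕ} (t : Fin m → ℝ) (k : Fin m → ℕ) {d : ℝ} (hd : 0 < d) (hdt : ∀ i, d < t i) :
    Integrable (fun ω => ∏ i, (X (t i) ω - X (t i - d) ω) ^ k i) μ ∧
    Tendsto (fun n : ℕ => (∫ ω, ∏ i, fallingCount (withOrigin (ξ n)) ⌊(n : ℝ) * (t i - d)⌋₊
        ⌊(n : ℝ) * t i⌋₊ (k i) ω ∂P n) / ∏ i, ((n : ℝ) ^ α) ^ k i) atTop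
      (𝓝 ((∏ i, (c * Real.Gamma α) ^ k i) *
        ∫ ω, ∏ i, (X (t i) ω - X (t i - d) ω) ^ k i ∂μ)) := by
  have ht0 : ∀ i, 0 < t i := fun i => hd.trans (hdt i)
  set T := ∑ i, t i with hTdef
  have hT : 0 ≤ T := Finset.sum_nonneg fun i _ => (ht0 i).le
  have htT : ∀ i, t i ≤ T := fun i =>
    Finset.single_le_sum (f := t) (fun i _ => (ht0 i).le) (Finset.mem_univ i)
  set K := ∑ i, k i with hKdef
  have hν : c * Real.Gamma α ≠ 0 := (mul_pos hc (Real.Gamma_pos_of_pos hα0)).ne'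
  -- At perturbation `n^{-α}` this is the scaled product of falling factorials; at `0` it is the
  -- product of pure powers. The `2m` coordinates are the times `t i` and `t i - d`.
  let G : (Fin (m + m) → ℝ) × ℝ → ℝ := fun x => ∏ i, ∏ j ∈ Finset.range (k i),
    (x.1 (Fin.castAdd m i) - x.1 (Fin.natAdd m i) - j * x.2)
  have hG : Continuous G := by fun_prop
  have hV := hX (m + m) (Fin.append t fun i => t i - d) (fun i => by
    induction i using Fin.addCases with
    | left i => simpa using ht0 i
    | right i => rw [Fin.append_right]; linarith [hdt i])
  have hε : Tendsto (fun n : ℕ => ((n : ℝ) ^ α)⁻¹) atTop (𝓝 0) :=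
    ((tendsto_rpow_atTop hα0).comp tendsto_natCast_atTop_atTop).inv_tendsto_atTop
  let A : ∀ n : ℕ, Ω' n → ℝ := fun n ω => ∏ i, fallingCount (withOrigin (ξ n))
    ⌊(n : ℝ) * (t i - d)⌋₊ ⌊(n : ℝ) * t i⌋₊ (k i) ω
  have hA : ∀ n, A n ∈ pastAlgebra (withOrigin (ξ n)) (⌊(n : ℝ) * T⌋₊ + 1) := by
    intro n
    have : A n = ∏ i, fallingCount (withOrigin (ξ n)) ⌊(n : ℝ) * (t i - d)⌋₊
        ⌊(n : ℝ) * t i⌋₊ (k i) := by ext ω; simp [A]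
    rw [this]
    refine prod_mem fun i _ => pastAlgebra_mono _ ?_ (fallingCount_mem _ _ _ _)
    have : ⌊(n : ℝ) * t i⌋₊ ≤ ⌊(n : ℝ) * T⌋₊ := Nat.floor_mono (by gcongr; exact htT i)
    lia
  have hGA : ∀ n : ℕ, 1 ≤ n → ∀ ω, G (fun i => scaledWalk α n (ξ n)
      (Fin.append t (fun i => t i - d) i) ω, ((n : ℝ) ^ α)⁻¹) = A n ω / ∏ i, ((n : ℝ) ^ α) ^ k i := by
    intro n hn ω
    simp only [G, A, Fin.append_left, Fin.append_right]
    rw [← Finset.prod_div_distrib]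
    refine Finset.prod_congr rfl fun i _ => ?_
    rw [scaledWalk_sub_scaledWalk α n (ξ n) (by linarith), fallingCount]
    rw [← Finset.card_range (k i), ← Finset.prod_const, Finset.card_range,
      ← Finset.prod_div_distrib]
    exact Finset.prod_congr rfl fun j _ => by rw [sub_div, div_eq_mul_inv (j : ℝ)]
  have hAbd : ∀ n ω, 0 ≤ A n ω ∧
      A n ω ≤ (∑ y ∈ Finset.Ioc 0 ⌊(n : ℝ) * T⌋₊, withOrigin (ξ n) y ω) ^ K := by
    intro n ω
    have h0 := fun i => fallingCount_nonneg (hξ n).withOrigin_binary ⌊(n : ℝ) * (t i - d)⌋₊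
        ⌊(n : ℝ) * t i⌋₊ (k i) ω
    refine ⟨Finset.prod_nonneg fun i _ => h0 i, ?_⟩
    rw [hKdef, ← Finset.prod_pow_eq_pow_sum]
    refine Finset.prod_le_prod (fun i _ => h0 i) fun i _ => ?_
    refine (fallingCount_le_pow (hξ n).withOrigin_binary _ _ _ _).trans ?_
    refine pow_le_pow_left₀ (Finset.sum_nonneg fun y _ => (hξ n).withOrigin_nonneg y ω) ?_ _
    refine Finset.sum_le_sum_of_subset_of_nonneg (Finset.Ioc_subset_Ioc (Nat.zero_le _) ?_)
      fun y _ _ => (hξ n).withOrigin_nonneg y ω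
    exact Nat.floor_mono (by gcongr; exact htT i)
  have hprodK : ∀ n : ℕ, ∏ i, ((n : ℝ) ^ α) ^ k i = ((n : ℝ) ^ α) ^ K := fun n => by
    rw [hKdef, Finset.prod_pow_eq_pow_sum]
  obtain ⟨C, hC⟩ := IsGBPStar.exists_scaled_moment_le hα0 hα1.le hc hT (2 * K)
  obtain ⟨h1, h2⟩ := tendsto_integral_of_sq_bounded_of_perturbation hV hε hG (C := C)
    (by
      filter_upwards [eventually_ge_atTop 1] with n hn
      simp only [hGA n hn, div_pow]
      exact ((hξ n).integrable_of_mem (pow_mem (hA n) 2)).div_const _)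
    (by
      filter_upwards [eventually_ge_atTop 1] with n hn
      refine (integral_mono ?_ ?_ fun ω => ?_).trans (hC n (P n) (ξ n) hn (hξ n))
      · simp only [hGA n hn, div_pow]
        exact ((hξ n).integrable_of_mem (pow_mem (hA n) 2)).div_const _
      · simp only [div_pow]
        exact ((hξ n).sum_pow_integrable _ _ _).div_const _
      · dsimp only
        rw [hGA n hn, hprodK, mul_comm 2 K, pow_mul, div_pow _ _ K]
        obtain ⟨h0, h1⟩ := hAbd n ω
        gcongr)
  have hG0 : ∀ ω, G (fun i => c * Real.Gamma α * X (Fin.append t (fun i => t i - d) i) ω, 0) =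
      (∏ i, (c * Real.Gamma α) ^ k i) * ∏ i, (X (t i) ω - X (t i - d) ω) ^ k i := by
    intro ω
    rw [← Finset.prod_mul_distrib]
    refine Finset.prod_congr rfl fun i _ => ?_
    simp only [Fin.append_left, Fin.append_right, mul_zero, sub_zero, Finset.prod_const,
      Finset.card_range]
    rw [← mul_sub, mul_pow]
  have hν' : (∏ i, (c * Real.Gamma α) ^ k i) ≠ 0 :=
    Finset.prod_ne_zero_iff.2 fun i _ => pow_ne_zero _ hν
  simp only [hG0] at h1 h2
  rw [integral_const_mul] at h2
  refine ⟨(integrable_const_mul_iff (IsUnit.mk0 _ hν') _).1 h1, h2.congr' ?_⟩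
  filter_upwards [eventually_ge_atTop 1] with n hn
  simp only [hGA n hn, integral_div]
  rfl

/-- The discrete bounds survive division by `n^{α ∑ k_i}` and the limit, and the powers of `c Γ(α)`
cancel. The longest entry gap gives the lower bound, the shortest the upper; `max` accounts for the
origin having no sites to its left. -/
theorem moment_increments_bounds (hα0 : 0 < α) (hα1 : α < 1) (hc : 0 < c)
    (hξ : ∀ n, IsGBPStar (fun x => c * (x : ℝ) ^ (α - 1)) (P n) (ξ n))
    (hX : ∀ (m : ℕ) (t : Fin m → ℝ), (∀ i, 0 < t i) →
      TendstoInDistribution (fun n ω (i : Fin m) => scaledWalk α n (ξ n) (t i) ω) atTop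
        (fun ω (i : Fin m) => c * Real.Gamma α * X (t i) ω) P μ)
    {m : ℕ} {t : Fin (m + 1) → ℝ} (ht0 : t 0 = 0) (htm : StrictMono t) (κ : Fin m → ℕ) {d : ℝ}
    (hd : 0 < d) (hgap : ∀ i : Fin m, d < t i.succ - t i.castSucc) :
    ∏ i : Fin m, (d ^ (κ i * α + 1) * ((κ i + 1).factorial /
        (Real.Gamma (κ i * α + 2) * Real.Gamma α) *
          (t i.succ - max (t i.castSucc - d) 0) ^ (α - 1))) ≤
      ∫ ω, ∏ i : Fin m, (X (t i.succ) ω - X (t i.succ - d) ω) ^ (κ i + 1) ∂μ ∧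
    ∫ ω, ∏ i : Fin m, (X (t i.succ) ω - X (t i.succ - d) ω) ^ (κ i + 1) ∂μ ≤
      ∏ i : Fin m, (d ^ (κ i * α + 1) * ((κ i + 1).factorial /
        (Real.Gamma (κ i * α + 2) * Real.Gamma α) *
          (t i.succ - d - t i.castSucc) ^ (α - 1))) := by
  have htn : ∀ j, 0 ≤ t j := fun j => ht0 ▸ htm.monotone (Fin.zero_le j)
  obtain ⟨-, hlim⟩ := integrable_and_tendsto_increments hα0 hα1 hc hξ hX (fun i : Fin m => t i.succ)
    (fun i => κ i + 1) hd (fun i => by linarith [hgap i, htn i.castSucc])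
  have hν : 0 < c * Real.Gamma α := mul_pos hc (Real.Gamma_pos_of_pos hα0)
  have hν' : 0 < ∏ i : Fin m, (c * Real.Gamma α) ^ (κ i + 1) :=
    Finset.prod_pos fun i _ => pow_pos hν _
  let p : ℕ → Fin (m + 1) → ℕ := fun n j => ⌊(n : ℝ) * (t j - d)⌋₊
  let q : ℕ → Fin (m + 1) → ℕ := fun n j => ⌊(n : ℝ) * t j⌋₊
  have hp : ∀ j, Tendsto (fun n => (p n j : ℝ) / n) atTop (𝓝 (max (t j - d) 0)) :=
    fun j => tendsto_floor_mul_div _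
  have hq : ∀ j, Tendsto (fun n => (q n j : ℝ) / n) atTop (𝓝 (t j)) := fun j => by
    have := tendsto_floor_mul_div (t j)
    rwa [max_eq_left (htn j)] at this
  have hqp : ∀ n (i : Fin m), q n i.castSucc ≤ p n i.succ := fun n i =>
    Nat.floor_mono (mul_le_mul_of_nonneg_left (by linarith [hgap i]) (Nat.cast_nonneg n))
  have hpq : ∀ n j, p n j ≤ q n j := fun n j =>
    Nat.floor_mono (mul_le_mul_of_nonneg_left (by linarith) (Nat.cast_nonneg n))
  have hqq : ∀ n (i : Fin m), p n i.castSucc ≤ q n i.succ := fun n i =>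
    (hpq n _).trans ((hqp n i).trans (hpq n _))
  have hsucc : ∀ i : Fin m, max (t i.succ - d) 0 = t i.succ - d := fun i =>
    max_eq_left (by linarith [hgap i, htn i.castSucc])
  have hbounds := fun n => ((hξ n).integral_prod_fallingCount_bounds (mul_rpow_nonneg hc.le)
    (mul_rpow_antitone hc.le hα1.le) (p n) (q n) κ
    (by simp only [p, ht0]; exact Nat.floor_of_nonpos
          (mul_nonpos_of_nonneg_of_nonpos (Nat.cast_nonneg n) (by linarith)))
    (by simp [q, ht0]) (hqp n)).2
  have hwin : ∀ i : Fin m, Tendsto (fun n => ((q n i.succ - p n i.succ : ℕ) : ℝ) / n) atTop (𝓝 d) := by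
    intro i
    have h1 := (hq i.succ).sub (hp i.succ)
    rw [hsucc, sub_sub_cancel] at h1
    refine h1.congr fun n => ?_
    rw [Nat.cast_sub (hpq n _), sub_div]
  have hlo : ∀ i : Fin m, Tendsto (fun n => ((q n i.succ - p n i.castSucc : ℕ) : ℝ) / n) atTop
      (𝓝 (t i.succ - max (t i.castSucc - d) 0)) := by
    intro i
    refine ((hq i.succ).sub (hp i.castSucc)).congr fun n => ?_
    rw [Nat.cast_sub (hqq n i), sub_div]
  have hhi : ∀ i : Fin m, Tendsto (fun n => ((p n i.succ + 1 - q n i.castSucc : ℕ) : ℝ) / n) atTop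
      (𝓝 (t i.succ - d - t i.castSucc)) := by
    intro i
    have h1 := ((hp i.succ).add (tendsto_one_div_atTop_nhds_zero_nat (𝕜 := ℝ))).sub (hq i.castSucc)
    rw [hsucc, add_zero] at h1
    refine h1.congr fun n => ?_
    rw [Nat.cast_sub ((hqp n i).trans (Nat.le_succ _)), sub_div]
    push_cast
    rw [add_div]
  have hden : ∀ n : ℕ, 0 ≤ ∏ i : Fin m, ((n : ℝ) ^ α) ^ (κ i + 1) := fun n =>
    Finset.prod_nonneg fun i _ => by positivity
  have hL := tendsto_finsetProd Finset.univ fun (i : Fin m) _ =>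
    tendsto_window hα0 hα1.le hc (κ i) (ℓ := t i.succ - max (t i.castSucc - d) 0)
      (by
        have h1 := hgap i
        have h2 := htn i.castSucc
        have : max (t i.castSucc - d) 0 ≤ t i.castSucc := max_le (by linarith) h2
        linarith) hd (hlo i) (hwin i)
  have hU := tendsto_finsetProd Finset.univ fun (i : Fin m) _ =>
    tendsto_window hα0 hα1.le hc (κ i) (ℓ := t i.succ - d - t i.castSucc)
      (by linarith [hgap i]) hd (hhi i) (hwin i)
  simp only [Finset.prod_mul_distrib (f := fun i : Fin m => (c * Real.Gamma α) ^ (κ i + 1))]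
    at hL hU
  constructor
  · refine le_of_mul_le_mul_left (le_of_tendsto_of_tendsto' hL hlim fun n => ?_) hν'
    rw [Finset.prod_div_distrib]
    exact div_le_div_of_nonneg_right (hbounds n).1 (hden n)
  · refine le_of_mul_le_mul_left (le_of_tendsto_of_tendsto' hlim hU fun n => ?_) hν'
    rw [Finset.prod_div_distrib]
    exact div_le_div_of_nonneg_right (hbounds n).2 (hden n)

/-- Divided by the claimed equivalent, both bounds keep only ratios of powers of entry gaps, which
tend to `1`; a squeeze concludes. -/
theorem isEquivalent_moment_increments (hα0 : 0 < α) (hα1 : α < 1) (hc : 0 < c)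
    (hξ : ∀ n, IsGBPStar (fun x => c * (x : ℝ) ^ (α - 1)) (P n) (ξ n))
    (hX : ∀ (m : ℕ) (t : Fin m → ℝ), (∀ i, 0 < t i) →
      TendstoInDistribution (fun n ω (i : Fin m) => scaledWalk α n (ξ n) (t i) ω) atTop
        (fun ω (i : Fin m) => c * Real.Gamma α * X (t i) ω) P μ)
    {m : ℕ} {t : Fin (m + 1) → ℝ} (ht0 : t 0 = 0) (htm : StrictMono t) (κ : Fin m → ℕ) :
    (fun d : ℝ => ∫ ω, ∏ i : Fin m, (X (t i.succ) ω - X (t i.succ - d) ω) ^ (κ i + 1) ∂μ)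
      ~[𝓝[>] 0] fun d : ℝ => ∏ i : Fin m, (d ^ (κ i * α + 1) * ((κ i + 1).factorial /
        (Real.Gamma (κ i * α + 2) * Real.Gamma α) * (t i.succ - t i.castSucc) ^ (α - 1))) := by
  have htn : ∀ j, 0 ≤ t j := fun j => ht0 ▸ htm.monotone (Fin.zero_le j)
  have hg : ∀ i : Fin m, 0 < t i.succ - t i.castSucc := fun i =>
    sub_pos.2 (htm Fin.castSucc_lt_succ)
  have hpos : ∀ d : ℝ, 0 < d → 0 < ∏ i : Fin m, (d ^ (κ i * α + 1) * ((κ i + 1).factorial /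
        (Real.Gamma (κ i * α + 2) * Real.Gamma α) * (t i.succ - t i.castSucc) ^ (α - 1))) := by
    intro d hd
    refine Finset.prod_pos fun i _ => ?_
    have := hg i
    have := Real.Gamma_pos_of_pos hα0
    have := Real.Gamma_pos_of_pos (show 0 < κ i * α + 2 by positivity)
    positivity
  have hfac : ∀ (ℓ : Fin m → ℝ → ℝ), (∀ i, Tendsto (ℓ i) (𝓝[>] 0) (𝓝 (t i.succ - t i.castSucc))) →
      Tendsto (fun d : ℝ => (∏ i : Fin m, (d ^ (κ i * α + 1) * ((κ i + 1).factorial /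
        (Real.Gamma (κ i * α + 2) * Real.Gamma α) * ℓ i d ^ (α - 1)))) /
        ∏ i : Fin m, (d ^ (κ i * α + 1) * ((κ i + 1).factorial /
        (Real.Gamma (κ i * α + 2) * Real.Gamma α) * (t i.succ - t i.castSucc) ^ (α - 1))))
        (𝓝[>] 0) (𝓝 1) := by
    intro ℓ hℓ
    have h1 := tendsto_finsetProd Finset.univ fun (i : Fin m) _ =>
      ((hℓ i).rpow_const (p := α - 1) (Or.inl (hg i).ne')).div_const
        ((t i.succ - t i.castSucc) ^ (α - 1))
    have h2 : ∏ i : Fin m, (t i.succ - t i.castSucc) ^ (α - 1) /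
        (t i.succ - t i.castSucc) ^ (α - 1) = 1 :=
      Finset.prod_eq_one fun i _ => div_self (Real.rpow_pos_of_pos (hg i) _).ne'
    rw [h2] at h1
    refine h1.congr' ?_
    filter_upwards [self_mem_nhdsWithin] with d hd
    rw [← Finset.prod_div_distrib]
    refine Finset.prod_congr rfl fun i _ => ?_
    have hd' := Real.rpow_pos_of_pos (Set.mem_Ioi.1 hd) (κ i * α + 1)
    have := Real.Gamma_pos_of_pos hα0
    have := Real.Gamma_pos_of_pos (show 0 < κ i * α + 2 by positivity)
    have hK : (0 : ℝ) < (κ i + 1).factorial / (Real.Gamma (κ i * α + 2) * Real.Gamma α) := by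
      positivity
    rw [mul_div_mul_left _ _ hd'.ne', mul_div_mul_left _ _ hK.ne']
  have hid : Tendsto (fun d : ℝ => d) (𝓝[>] 0) (𝓝 0) := tendsto_nhdsWithin_of_tendsto_nhds tendsto_id
  have hlo := hfac (fun i d => t i.succ - max (t i.castSucc - d) 0) fun i => by
    have h := (((hid.const_sub (t i.castSucc)).max (tendsto_const_nhds (x := (0 : ℝ)))).const_sub
      (t i.succ))
    simpa [htn] using h
  have hhi := hfac (fun i d => t i.succ - d - t i.castSucc) fun i => by
    simpa using (hid.const_sub (t i.succ)).sub_const (t i.castSucc)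
  have hsmall : ∀ᶠ d : ℝ in 𝓝[>] 0, ∀ i : Fin m, d < t i.succ - t i.castSucc :=
    eventually_all.2 fun i => hid.eventually_lt_const (hg i)
  refine Asymptotics.isEquivalent_of_tendsto_one ?_
  refine tendsto_of_tendsto_of_tendsto_of_le_of_le' hlo hhi ?_ ?_
  · filter_upwards [self_mem_nhdsWithin, hsmall] with d hd hds
    exact div_le_div_of_nonneg_right
      (moment_increments_bounds hα0 hα1 hc hξ hX ht0 htm κ hd hds).1 (hpos d hd).le
  · filter_upwards [self_mem_nhdsWithin, hsmall] with d hd hds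
    exact div_le_div_of_nonneg_right
      (moment_increments_bounds hα0 hα1 hc hξ hX ht0 htm κ hd hds).2 (hpos d hd).le

end Limits

theorem proposition3p12 {Ω : Type*} [MeasurableSpace Ω] (μ : Measure Ω) [IsProbabilityMeasure μ]
    (α : ℝ) (hα0 : 0 < α) (hα1 : α < 1) (X : ℝ → Ω → ℝ) (hX : IsMLStar α μ X) :
    (∀ s t : ℝ, 0 < s → 0 < t →
      (∀ d : ℝ, 0 < d → d < s → d < t →
        Integrable (fun ω => (X s ω - X (s - d) ω) * (X (s + t) ω - X (s + t - d) ω)) μ) ∧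
      (fun d : ℝ => ∫ ω, (X s ω - X (s - d) ω) * (X (s + t) ω - X (s + t - d) ω) ∂μ)
        ~[𝓝[>] 0]
      (fun d : ℝ => (Real.Gamma α) ^ (-2 : ℤ) * d ^ 2 * s ^ (α - 1) * t ^ (α - 1))) ∧
    (∀ (m : ℕ) (t : Fin (m + 1) → ℝ) (k : Fin m → ℕ),
      t 0 = 0 → StrictMono t → (∀ i, 1 ≤ k i) →
      (∀ d : ℝ, 0 < d → (∀ i : Fin m, d < t i.succ) →
        Integrable (fun ω => ∏ i : Fin m, (X (t i.succ) ω - X (t i.succ - d) ω) ^ k i) μ) ∧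
      (fun d : ℝ => ∫ ω, ∏ i : Fin m, (X (t i.succ) ω - X (t i.succ - d) ω) ^ k i ∂μ)
        ~[𝓝[>] 0]
      (fun d : ℝ => d ^ (∑ i : Fin m, (α * ((k i : ℝ) - 1) + 1)) *
        ∏ i : Fin m, (((k i).factorial : ℝ) /
            (Real.Gamma (((k i : ℝ) - 1) * α + 2) * Real.Gamma α) *
          (t i.succ - t i.castSucc) ^ (α - 1)))) := by
  obtain ⟨c, hc, -, Ω', _, P, _, ξ, hξ, hconv⟩ := hX
  have main : ∀ (m : ℕ) (t : Fin (m + 1) → ℝ) (k : Fin m → ℕ),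
      t 0 = 0 → StrictMono t → (∀ i, 1 ≤ k i) →
      (∀ d : ℝ, 0 < d → (∀ i : Fin m, d < t i.succ) →
        Integrable (fun ω => ∏ i : Fin m, (X (t i.succ) ω - X (t i.succ - d) ω) ^ k i) μ) ∧
      (fun d : ℝ => ∫ ω, ∏ i : Fin m, (X (t i.succ) ω - X (t i.succ - d) ω) ^ k i ∂μ)
        ~[𝓝[>] 0]
      (fun d : ℝ => d ^ (∑ i : Fin m, (α * ((k i : ℝ) - 1) + 1)) *
        ∏ i : Fin m, (((k i).factorial : ℝ) /
            (Real.Gamma (((k i : ℝ) - 1) * α + 2) * Real.Gamma α) *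
          (t i.succ - t i.castSucc) ^ (α - 1))) := by
    intro m t k ht0 htm hk
    refine ⟨fun d hd hdt => (integrable_and_tendsto_increments hα0 hα1 hc hξ hconv
      (fun i : Fin m => t i.succ) k hd hdt).1, ?_⟩
    obtain ⟨κ, rfl⟩ : ∃ κ : Fin m → ℕ, k = fun i => κ i + 1 :=
      ⟨fun i => k i - 1, funext fun i => (Nat.sub_add_cancel (hk i)).symm⟩
    refine (isEquivalent_moment_increments hα0 hα1 hc hξ hconv ht0 htm κ).congr_right ?_
    filter_upwards [self_mem_nhdsWithin] with d hd
    rw [Finset.prod_mul_distrib, Real.rpow_sum_of_pos (Set.mem_Ioi.1 hd)]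
    push_cast
    simp only [add_sub_cancel_right, mul_comm α]
  refine ⟨fun s t hs ht => ?_, main⟩
  have htm : StrictMono (![0, s, s + t] : Fin 3 → ℝ) := by
    rw [Fin.strictMono_iff_lt_succ]
    intro i
    fin_cases i
    · simpa using hs
    · simpa using ht
  -- With both exponents equal to one, the extra Gamma factors are `Γ(2) = 1` and the power of `d`
  -- is `d^2`.
  obtain ⟨h1, h2⟩ := main 2 ![0, s, s + t] (fun _ => 1) rfl htm fun _ => le_rfl
  simp only [Fin.prod_univ_two, Fin.sum_univ_two, Fin.forall_fin_two, pow_one] at h1 h2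
  constructor
  · intro d hd hds hdt
    exact h1 d hd ⟨hds, show d < s + t by linarith⟩
  · refine h2.congr_right (Eventually.of_forall fun d => ?_)
    have hΓ := (Real.Gamma_pos_of_pos hα0).ne'
    norm_num
    rw [show (![0, s, s + t] : Fin 3 → ℝ) 2 - s = t from add_sub_cancel_left s t]
    ring
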